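/- There is an absolute constant $c>0$ such that for every real $\varepsilon>0$ there is $q_0=q_0(\varepsilon)$ with the following property. Let $\delta$ be a real number with $0<\delta\le c\,\varepsilon^5$, let $p$ be a prime, and let $K$ be a finite extension of $\mathbb{Q}_p$ (no bound on its degree or its ramification index is assumed), with ring of integers $\mathcal{O}$, uniformizing element $\mathfrak{p}$ and residue field $\mathfrak{f}=\mathcal{O}/\langle\mathfrak{p}\rangle$ of cardinality $|\mathfrak{f}|\ge q_0$. For $m\ge 0$ let $\pi_{\mathfrak{p}^m}$ denote the residue map $\mathcal{O}\to\mathcal{O}/\langle\mathfrak{p}^m\rangle$ and also, for $m\le N$, the induced map $\mathcal{O}/\langle\mathfrak{p}^N\rangle\to\mathcal{O}/\langle\mathfrak{p}^m\rangle$. For a subset $A$ of a commutative ring and $j\ge 1$ put $$\langle A\rangle_j:=\textstyle\sum_j\prod_j A-\sum_j\prod_j A,\qquad \sum_j B:=\Big\{\sum_{i=1}^j b_i : b_i\in B\Big\},\qquad \prod_j B:=\Big\{\prod_{i=1}^j b_i : b_i\in B\Big\},$$ where the minus sign denotes the difference set $\{x-y\}$. Let $N\ge 0$ be an integer, let $\Omega\subseteq\mathcal{O}$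 be such that $\pi_{\mathfrak{p}}$ restricts to a bijection from $\Omega$ onto $\mathfrak{f}^\times$, and let $A\subseteq\mathcal{O}/\langle\mathfrak{p}^N\rangle$ satisfy 1. $|A|\le|\mathfrak{f}|^{N(1-\varepsilon)}$; 2. $|\pi_{\mathfrak{p}^i}(A)|\ge|\mathfrak{f}|^{i\varepsilon}$ for every integer $i$ with $N\delta\le i\le N$; 3. for $i=0$ and for $i=1$ there are $a_{i1},a_{i2}\in A$ with $a_{i1}-a_{i2}\in\pi_{\mathfrak{p}^N}(\mathfrak{p}^i\mathcal{O}\setminus\mathfrak{p}^{i+1}\mathcal{O})$. Then $$\max_{\omega\in\Omega}\big|\langle A\rangle_6+\pi_{\mathfrak{p}^N}(\omega)\langle A\rangle_6\big|\ge|A|\,|\mathfrak{f}|^{N\delta}.$$ -/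

import Mathlib

universe u

open scoped Pointwise

/-- `∑_j A`: the set of all sums of `j` elements of `A` (repetitions allowed). -/
def sumSet {R : Type*} [CommRing R] (j : ℕ) (A : Set R) : Set R :=
  {x | ∃ a : Fin j → R, (∀ i, a i ∈ A) ∧ x = ∑ i, a i}

/-- `∏_j A`: the set of all products of `j` elements of `A` (repetitions allowed). -/
def prodSet {R : Type*} [CommRing R] (j : ℕ) (A : Set R) : Set R :=
  {x | ∃ a : Fin j → R, (∀ i, a i ∈ A) ∧ x = ∏ i, a i}

/-- `⟨A⟩_j := ∑_j ∏_j A - ∑_j ∏_j A` (difference set). -/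
def gen {R : Type*} [CommRing R] (A : Set R) (j : ℕ) : Set R :=
  sumSet j (prodSet j A) - sumSet j (prodSet j A)

/-! Suppose no ω gives growth. Work in R = 𝒪/𝔭^N with entropies measured in units of log q.
Condition 3 puts a unit c in A, so X = c^5(a − c), with a uniform on A, is injective with values in
⟨A⟩_6. Let f(j) ∈ [0,1] be the mean information in the j-th digit of X given the earlier ones,
truncated at 1. Let Y be independent of X with values in ⟨A⟩_6 and digit informations h(j). Two
pairs with different next digit of Y collide in X + ωY for at most one ω, so for average ω the j-th
digit of X + ωY carries about 1 − (1 − f(j))(1 − h(j)). The digits of X already account for log |A|,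
so lack of growth forces Σ h(j)(1 − f(j)) ≤ 2δN (`sum_digitEntropy_mul_le`).

Taking Y = c^4(a − b)(x − c) with a − b of valuation v shifts the digits by v. Hence D(v) = Σ f(j)(1
− f(j+v)) ≤ 2δN for every v in the set V of valuations of differences. By condition 2, for i ≥ Nδ, V
has density at least ε/2 on [0,i) and f has mass at least iε/2 − 2δN there. D is subadditive, so
Schnirelmann's basis theorem, with a separate argument for short shifts, gives D(s) ≤ 134δN/ε² for
all s < N (`shiftDefect_le_of_density`).

However, Σ_s D(s) = Σ_t (1 − f(t)) Σ_{j≤t} f(j) is of order at least ε³N², since f has mass on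
initial segments while condition 1 gives Σ(1 − f) ≥ εN. For δ = ε^5/2000 the two bounds clash
(`false_of_shiftDefect_small`). -/

/-! ### The ring of integers of K -/

section PadicIntegers

variable {p : ℕ} [Fact p.Prime] {K : Type*} [Field K] [Algebra ℚ_[p] K]
  [FiniteDimensional ℚ_[p] K] [Algebra ℤ_[p] K] [IsScalarTower ℤ_[p] ℚ_[p] K]

/-- The spectral norm is at most 1 exactly when the minimal polynomial over ℚ_p has coefficients in
ℤ_p; since ℤ_p is integrally closed, this is integrality. -/
theorem Padic.isIntegral_iff_spectralNorm_le_one (x : K) :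
    IsIntegral ℤ_[p] x ↔ spectralNorm ℚ_[p] K x ≤ 1 := by
  have hx : IsIntegral ℚ_[p] x := Algebra.IsIntegral.isIntegral x
  constructor
  · intro h
    have h1 : minpoly ℚ_[p] x = (minpoly ℤ_[p] x).map (algebraMap ℤ_[p] ℚ_[p]) :=
      minpoly.isIntegrallyClosed_eq_field_fractions' ℚ_[p] h
    have h2 := (spectralValue_le_one_iff (minpoly.monic hx)).2 (fun n => by
      rw [h1, Polynomial.coeff_map]
      exact PadicInt.norm_le_one _)
    exact h2
  · intro h
    have h2 := (spectralValue_le_one_iff (minpoly.monic hx)).1 h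
    have h3 : minpoly ℚ_[p] x ∈ Polynomial.lifts (algebraMap ℤ_[p] ℚ_[p]) := by
      rw [Polynomial.lifts_iff_coeff_lifts]
      intro n
      exact ⟨⟨_, h2 n⟩, rfl⟩
    obtain ⟨r, hr, -, hm⟩ := Polynomial.lifts_and_natDegree_eq_and_monic h3 (minpoly.monic hx)
    refine ⟨r, hm, ?_⟩
    have h4 := minpoly.aeval ℚ_[p] x
    rw [← hr, Polynomial.aeval_map_algebraMap] at h4
    exact h4

/-- The spectral norm is multiplicative and at most 1 on integers, so units are the elements of norm
exactly 1; the ultrametric inequality then makes nonunits closed under addition. -/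
instance Padic.isLocalRing_integralClosure : IsLocalRing (integralClosure ℤ_[p] K) := by
  have hmul : ∀ x y : K, spectralNorm ℚ_[p] K (x * y) =
      spectralNorm ℚ_[p] K x * spectralNorm ℚ_[p] K y := fun x y => spectralAlgNorm_mul x y
  have hone : spectralNorm ℚ_[p] K 1 = 1 := spectralNorm_one
  have hle : ∀ x : integralClosure ℤ_[p] K, spectralNorm ℚ_[p] K x ≤ 1 := fun x =>
    (Padic.isIntegral_iff_spectralNorm_le_one (p := p) (x : K)).1 x.2
  have hnn : ∀ x : K, 0 ≤ spectralNorm ℚ_[p] K x := spectralNorm_nonneg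
  have key : ∀ x : integralClosure ℤ_[p] K, IsUnit x ↔ spectralNorm ℚ_[p] K x = 1 := by
    intro x
    constructor
    · rintro ⟨v, rfl⟩
      have h1 := hmul ((v : integralClosure ℤ_[p] K) : K)
        ((↑v⁻¹ : integralClosure ℤ_[p] K) : K)
      have h2 : ((v : integralClosure ℤ_[p] K) : K) *
        ((↑v⁻¹ : integralClosure ℤ_[p] K) : K) = 1 := by
          exact_mod_cast congrArg Subtype.val (Units.mul_inv v)
      rw [h2, hone] at h1
      nlinarith [hle v, hle ↑v⁻¹, hnn ((v : integralClosure ℤ_[p] K) : K),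
        hnn ((↑v⁻¹ : integralClosure ℤ_[p] K) : K)]
    · intro h
      have hx0 : (x : K) ≠ 0 := by
        intro h0
        rw [h0, spectralNorm_zero] at h
        exact zero_ne_one h
      have h1 := hmul (x : K) (x : K)⁻¹
      rw [mul_inv_cancel₀ hx0, hone, h, one_mul] at h1
      have h2 : IsIntegral ℤ_[p] (x : K)⁻¹ :=
        (Padic.isIntegral_iff_spectralNorm_le_one (p := p) _).2 h1.ge
      exact IsUnit.of_mul_eq_one (⟨(x : K)⁻¹, h2⟩ : integralClosure ℤ_[p] K)
        (Subtype.ext (mul_inv_cancel₀ hx0))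
  refine IsLocalRing.of_nonunits_add fun a b ha hb => ?_
  rw [mem_nonunits_iff, key] at *
  have h := isNonarchimedean_spectralNorm (K := ℚ_[p]) (L := K) (a : K) (b : K)
  have ha' := lt_of_le_of_ne (hle a) ha
  have hb' := lt_of_le_of_ne (hle b) hb
  exact (h.trans_lt (max_lt ha' hb')).ne

/-- A Dedekind domain with finitely many maximal ideals is principal, and here there is only one. -/
theorem Padic.isMaximal_span_irreducible {ϖ : integralClosure ℤ_[p] K} (h : Irreducible ϖ) :
    (Ideal.span {ϖ}).IsMaximal := by
  have : IsDedekindDomain (integralClosure ℤ_[p] K) :=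
    IsIntegralClosure.isDedekindDomain ℤ_[p] ℚ_[p] K _
  have : IsPrincipalIdealRing (integralClosure ℤ_[p] K) := by
    apply IsPrincipalIdealRing.of_finite_maximals
    refine (Set.finite_singleton (IsLocalRing.maximalIdeal _)).subset fun I hI => ?_
    exact IsLocalRing.eq_maximalIdeal hI
  exact PrincipalIdealRing.isMaximal_of_irreducible h

end PadicIntegers

/-- The features of `𝒪 ⧸ 𝔭 ^ N` used below, for `𝒪` a discrete valuation ring with residue field of
cardinality `q`; here `π` is the image of a uniformizer. -/
structure IsTruncatedDVR {R : Type*} [CommRing R] (π : R) (N q : ℕ) : Prop where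
  pow_eq_zero : π ^ N = 0
  dvd_of_mul_dvd_mul : ∀ i j : ℕ, i + j ≤ N → ∀ z : R, π ^ (i + j) ∣ π ^ i * z → π ^ j ∣ z
  isUnit_of_not_dvd : ∀ x : R, ¬ π ∣ x → IsUnit x
  exists_digit : ∃ χ : ℕ → R → Fin q, ∀ (j : ℕ) (x y : R), π ^ j ∣ x → π ^ j ∣ y →
    χ j x = χ j y → π ^ (j + 1) ∣ x - y

/-! ### Quotients by powers of a principal maximal ideal -/

section QuotientPow

variable {O : Type*} [CommRing O]

theorem Ideal.Quotient.pow_mk_dvd_mk_iff {ϖ : O} {N j : ℕ} (hj : j ≤ N) (z : O) :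
    (Ideal.Quotient.mk (Ideal.span {ϖ} ^ N) ϖ) ^ j ∣ Ideal.Quotient.mk (Ideal.span {ϖ} ^ N) z ↔
      z ∈ Ideal.span {ϖ} ^ j := by
  rw [Ideal.span_singleton_pow ϖ j, Ideal.mem_span_singleton]
  constructor
  · rintro ⟨w, hw⟩
    obtain ⟨w, rfl⟩ := Ideal.Quotient.mk_surjective w
    rw [← map_pow, ← map_mul, Ideal.Quotient.eq, Ideal.span_singleton_pow,
      Ideal.mem_span_singleton] at hw
    have := (pow_dvd_pow ϖ hj).trans hw
    exact (dvd_sub_left (Dvd.intro _ rfl)).1 this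
  · rintro ⟨w, rfl⟩
    rw [map_mul, map_pow]
    exact Dvd.intro _ rfl

theorem isTruncatedDVR_quotient_pow [IsDomain O] {ϖ : O} (h0 : ϖ ≠ 0)
    [hmax : (Ideal.span {ϖ}).IsMaximal] [Finite (O ⧸ Ideal.span {ϖ})] (N : ℕ) :
    IsTruncatedDVR (Ideal.Quotient.mk (Ideal.span {ϖ} ^ N) ϖ) N
      (Nat.card (O ⧸ Ideal.span {ϖ})) where
  pow_eq_zero := by
    rw [← map_pow, Ideal.Quotient.eq_zero_iff_mem, Ideal.span_singleton_pow]
    exact Ideal.mem_span_singleton_self _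
  dvd_of_mul_dvd_mul i j hij z h := by
    obtain ⟨z, rfl⟩ := Ideal.Quotient.mk_surjective z
    rw [← map_pow (Ideal.Quotient.mk (Ideal.span {ϖ} ^ N)) ϖ i, ← map_mul,
      Ideal.Quotient.pow_mk_dvd_mk_iff hij, Ideal.span_singleton_pow,
      Ideal.mem_span_singleton, pow_add] at h
    rw [Ideal.Quotient.pow_mk_dvd_mk_iff (by omega), Ideal.span_singleton_pow,
      Ideal.mem_span_singleton]
    exact (mul_dvd_mul_iff_left (pow_ne_zero i h0)).1 h
  isUnit_of_not_dvd x hx := by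
    obtain ⟨x, rfl⟩ := Ideal.Quotient.mk_surjective x
    apply Ideal.Quotient.isUnit_mk_pow_of_notMem
    intro h
    obtain ⟨w, rfl⟩ := Ideal.mem_span_singleton.1 h
    exact hx (by rw [map_mul]; exact Dvd.intro _ rfl)
  exists_digit := by
    classical
    let e := Finite.equivFin (O ⧸ Ideal.span {ϖ})
    have hs := Ideal.Quotient.mk_surjective (I := Ideal.span {ϖ} ^ N)
    let g := Function.surjInv hs
    have hg : ∀ x, Ideal.Quotient.mk _ (g x) = x := Function.surjInv_eq hs
    -- The digit of x at level j is the residue of a lift of a chosen cofactor of π^j. The cofactor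
    -- is not unique, but only the implication from equal digits to divisibility is needed. `e 0` is
    -- a dummy value.
    refine ⟨fun j x => if h : Ideal.Quotient.mk (Ideal.span {ϖ} ^ N) ϖ ^ j ∣ x then
      e (Ideal.Quotient.mk _ (g h.choose)) else e 0, fun j x y hx hy hxy => ?_⟩
    simp only [dif_pos hx, dif_pos hy] at hxy
    rw [EmbeddingLike.apply_eq_iff_eq, Ideal.Quotient.eq,
      Ideal.mem_span_singleton] at hxy
    obtain ⟨w, hw⟩ := hxy
    have h1 : x - y = Ideal.Quotient.mk (Ideal.span {ϖ} ^ N) ϖ ^ j *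
        (hx.choose - hy.choose) := by
      rw [mul_sub, ← hx.choose_spec, ← hy.choose_spec]
    have h2 : hx.choose - hy.choose = Ideal.Quotient.mk (Ideal.span {ϖ} ^ N) (ϖ * w) := by
      rw [← hw, map_sub, hg, hg]
    rw [h1, h2, map_mul, pow_succ]
    exact mul_dvd_mul_left _ (Dvd.intro _ rfl)

end QuotientPow

/-! ### Valuations in a truncated discrete valuation ring -/

section TruncatedDVR

variable {R : Type*} [CommRing R] {π : R} {N q : ℕ}

theorem IsTruncatedDVR.exists_eq_pow_mul_unit (h : IsTruncatedDVR π N q) {x : R} {j : ℕ}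
    (h1 : π ^ j ∣ x) (h2 : ¬ π ^ (j + 1) ∣ x) : ∃ v : R, IsUnit v ∧ x = π ^ j * v := by
  obtain ⟨v, rfl⟩ := h1
  refine ⟨v, h.isUnit_of_not_dvd v fun hv => h2 ?_, rfl⟩
  rw [pow_succ]
  exact mul_dvd_mul_left _ hv

theorem IsTruncatedDVR.mul_dvd_iff (h : IsTruncatedDVR π N q) {d : R} {i j : ℕ} (hij : i + j ≤ N)
    (h1 : π ^ i ∣ d) (h2 : ¬ π ^ (i + 1) ∣ d) (z : R) : π ^ (i + j) ∣ d * z ↔ π ^ j ∣ z := by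
  obtain ⟨v, hv, rfl⟩ := h.exists_eq_pow_mul_unit h1 h2
  constructor
  · intro hd
    have := h.dvd_of_mul_dvd_mul i j hij (v * z) (by rwa [← mul_assoc])
    exact hv.dvd_mul_left.1 this
  · intro hz
    rw [pow_add, mul_assoc]
    exact mul_dvd_mul_left _ (hz.mul_left _)

end TruncatedDVR

/-! ### Schnirelmann's theorem on an initial segment -/

section Schnirelmann

open Finset

/-- Schnirelmann's inequality for counting functions on an initial segment. -/
theorem schnirelmann_sumset_card {A B C : Set ℕ} [DecidablePred (· ∈ A)] [DecidablePred (· ∈ B)]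
    [DecidablePred (· ∈ C)] {β : ℝ} {N : ℕ} (hA : 0 ∈ A) (hB : 0 ∈ B)
    (hC : ∀ a ∈ A, ∀ b ∈ B, a + b ∈ C)
    (h : ∀ n, n < N → β * n ≤ #{x ∈ Icc 1 n | x ∈ B}) (n : ℕ) (hn : n < N) :
    (#{x ∈ Icc 1 n | x ∈ A} : ℝ) + β * (n - #{x ∈ Icc 1 n | x ∈ A}) ≤
      #{x ∈ Icc 1 n | x ∈ C} := by
  induction n using Nat.strong_induction_on with
  | _ n ih =>
  rcases Nat.eq_zero_or_pos n with rfl | hpos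
  · simp
  by_cases hnA : n ∈ A
  · obtain ⟨m, rfl⟩ : ∃ m, n = m + 1 := ⟨n - 1, by omega⟩
    have h1 := ih m (by omega) (by omega)
    have hnC : m + 1 ∈ C := by simpa using hC _ hnA _ hB
    have e : ∀ (S : Set ℕ) [DecidablePred (· ∈ S)], m + 1 ∈ S →
        #{x ∈ Icc 1 (m + 1) | x ∈ S} = #{x ∈ Icc 1 m | x ∈ S} + 1 := by
      intro S _ hS
      rw [← Finset.insert_Icc_right_eq_Icc_add_one (by omega), filter_insert, if_pos hS,
        card_insert_of_notMem (by simp)]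
    rw [e A hnA, e C hnC]
    push_cast
    nlinarith
  · -- the largest element of `A` below `n`
    have hne : ({x ∈ range n | x ∈ A} : Finset ℕ).Nonempty := ⟨0, by simp [hA, hpos]⟩
    set a := ({x ∈ range n | x ∈ A} : Finset ℕ).max' hne with ha
    have ham := Finset.max'_mem _ hne
    rw [← ha, mem_filter, mem_range] at ham
    have hmax : ∀ x, x < n → x ∈ A → x ≤ a := fun x hx hxA =>
      Finset.le_max' _ _ (by simp [hx, hxA])
    have h1 := ih a ham.1 (by omega)
    have h2 := h (n - a) (by omega)
    have eA : ({x ∈ Icc 1 n | x ∈ A} : Finset ℕ) = {x ∈ Icc 1 a | x ∈ A} := by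
      ext x
      simp only [mem_filter, mem_Icc]
      constructor
      · rintro ⟨⟨h1, h2⟩, h3⟩
        refine ⟨⟨h1, hmax x (lt_of_le_of_ne h2 ?_) h3⟩, h3⟩
        rintro rfl
        exact hnA h3
      · rintro ⟨⟨h1, h2⟩, h3⟩
        exact ⟨⟨h1, by omega⟩, h3⟩
    -- The translate a + B fills part of the gap of A after a, disjointly from what C already has up
    -- to a.
    have hcard : #{x ∈ Icc 1 a | x ∈ C} + #{x ∈ Icc 1 (n - a) | x ∈ B} ≤
        #{x ∈ Icc 1 n | x ∈ C} := by
      rw [← card_map (s := {x ∈ Icc 1 (n - a) | x ∈ B}) (addLeftEmbedding a),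
        ← card_union_of_disjoint]
      · apply card_le_card
        intro x
        simp only [mem_union, mem_filter, mem_Icc, mem_map, addLeftEmbedding_apply]
        rintro (⟨⟨h1, h2⟩, h3⟩ | ⟨b, ⟨⟨h1, h2⟩, h3⟩, rfl⟩)
        · exact ⟨⟨h1, by omega⟩, h3⟩
        · exact ⟨⟨by omega, by omega⟩, hC _ ham.2 _ h3⟩
      · rw [disjoint_left]
        intro x
        simp only [mem_filter, mem_Icc, mem_map, addLeftEmbedding_apply]
        rintro ⟨⟨h1, h2⟩, h3⟩ ⟨b, ⟨⟨h1', h2'⟩, h3'⟩, rfl⟩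
        omega
    have hcard' : (#{x ∈ Icc 1 a | x ∈ C} : ℝ) + #{x ∈ Icc 1 (n - a) | x ∈ B} ≤
        #{x ∈ Icc 1 n | x ∈ C} := by exact_mod_cast hcard
    rw [eA]
    rw [Nat.cast_sub ham.1.le] at h2
    linarith

/-- Numbers that are sums of `k` elements of `W`. -/
def sumsOf (W : Set ℕ) : ℕ → Set ℕ
  | 0 => {0}
  | k + 1 => {n | ∃ a ∈ sumsOf W k, ∃ b ∈ W, n = a + b}

theorem sumsOf_add {W : Set ℕ} {k l : ℕ} {a b : ℕ} (ha : a ∈ sumsOf W k) (hb : b ∈ sumsOf W l) :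
    a + b ∈ sumsOf W (k + l) := by
  induction l generalizing b with
  | zero =>
    obtain rfl : b = 0 := hb
    exact ha
  | succ l ih =>
    obtain ⟨c, hc, d, hd, rfl⟩ := hb
    exact ⟨a + c, ih hc, d, hd, by ring⟩

theorem zero_mem_sumsOf {W : Set ℕ} (h0 : 0 ∈ W) (k : ℕ) : 0 ∈ sumsOf W k := by
  induction k with
  | zero => rfl
  | succ k ih => exact ⟨0, ih, 0, h0, rfl⟩

open Classical in
-- Each further summand multiplies the missing proportion by at most 1 − β.
theorem card_sumsOf_ge {W : Set ℕ} {β : ℝ} {N : ℕ} (h0 : 0 ∈ W) (hβ1 : β ≤ 1)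
    (h : ∀ n, n < N → β * n ≤ #{x ∈ Icc 1 n | x ∈ W}) (k : ℕ) :
    ∀ n, n < N → (1 - (1 - β) ^ k) * n ≤ #{x ∈ Icc 1 n | x ∈ sumsOf W k} := by
  induction k with
  | zero => simp
  | succ k ih =>
    intro n hn
    have h1 := ih n hn
    have h2 := schnirelmann_sumset_card (zero_mem_sumsOf h0 k) h0
      (C := sumsOf W (k + 1)) (fun a ha b hb => ⟨a, ha, b, hb, rfl⟩) h n hn
    rw [pow_succ]
    nlinarith

/-- A set of density at least `β` on an initial segment is a basis of order `2⌈1/β⌉` there. -/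
theorem mem_sumsOf_of_density {W : Set ℕ} [DecidablePred (· ∈ W)] {β : ℝ} {N : ℕ} (h0 : 0 ∈ W)
    (hβ0 : 0 < β) (hβ1 : β ≤ 1)
    (h : ∀ n, n < N → β * n ≤ #{x ∈ Icc 1 n | x ∈ W}) {n : ℕ} (hn : n < N) :
    n ∈ sumsOf W (⌈1 / β⌉₊ + ⌈1 / β⌉₊) := by
  classical
  set m := ⌈1 / β⌉₊ with hm
  have hm1 : 1 ≤ m * β := by
    have := Nat.le_ceil (1 / β)
    rw [div_le_iff₀ hβ0] at this
    exact this
  have hhalf : (1 - β) ^ m ≤ 1 / 2 := by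
    have h1 : (1 - β) ^ m ≤ Real.exp (-β) ^ m :=
      pow_le_pow_left₀ (by linarith) (by linarith [Real.add_one_le_exp (-β)]) m
    have h2 : Real.exp (-β) ^ m = Real.exp (-(m * β)) := by
      rw [← Real.exp_nat_mul]; ring_nf
    have h3 : Real.exp (-(m * β)) ≤ Real.exp (-1) := Real.exp_le_exp.2 (by linarith)
    have h4 : Real.exp (-1) ≤ 1 / 2 := by
      rw [Real.exp_neg, one_div]
      exact inv_anti₀ (by norm_num) (by linarith [Real.add_one_le_exp (1 : ℝ)])
    linarith
  have hd := card_sumsOf_ge h0 hβ1 (by convert h) m n hn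
  set C := sumsOf W m with hC
  by_cases hnC : n ∈ C
  · simpa using sumsOf_add hnC (zero_mem_sumsOf h0 m)
  have hn0 : 0 < n := by
    rcases Nat.eq_zero_or_pos n with rfl | hp
    · exact absurd (zero_mem_sumsOf h0 m) hnC
    · exact hp
  set F : Finset ℕ := {x ∈ Icc 1 n | x ∈ C} with hF
  have hF1 : F ⊆ Icc 1 (n - 1) := by
    intro x hx
    rw [hF, mem_filter, mem_Icc] at hx
    have : x ≠ n := by rintro rfl; exact hnC hx.2
    rw [mem_Icc]; omega
  have hinj : Set.InjOn (fun x => n - x) (F : Set ℕ) := by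
    intro x hx y hy hxy
    have h1 := mem_Icc.1 (hF1 hx)
    have h2 := mem_Icc.1 (hF1 hy)
    simp only at hxy
    omega
  have hF2 : F.image (fun x => n - x) ⊆ Icc 1 (n - 1) := by
    intro y hy
    obtain ⟨x, hx, rfl⟩ := mem_image.1 hy
    have h1 := mem_Icc.1 (hF1 hx)
    rw [mem_Icc]; omega
  -- Now C has density at least 1/2. If n ∉ C, then F and n − F both lie in [1, n − 1] and have at
  -- least n/2 elements each, so they meet and n is a sum of two elements of C.
  have hnd : ¬ Disjoint F (F.image (fun x => n - x)) := by
    intro hdis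
    have h1 := card_le_card (union_subset hF1 hF2)
    rw [card_union_of_disjoint hdis, card_image_of_injOn hinj, Nat.card_Icc] at h1
    have h2 : (n : ℝ) ≤ 2 * #F := by nlinarith
    have h3 : n ≤ 2 * #F := by exact_mod_cast h2
    omega
  rw [not_disjoint_iff] at hnd
  obtain ⟨x, hx, hx'⟩ := hnd
  obtain ⟨y, hy, rfl⟩ := mem_image.1 hx'
  have h1 := mem_Icc.1 (hF1 hy)
  have h2 := sumsOf_add (mem_filter.1 hx).2 (mem_filter.1 hy).2
  rwa [Nat.sub_add_cancel (by omega)] at h2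

end Schnirelmann

/-! ### Approximate translation invariance of a fuzzy set -/

section ShiftDefect

open Finset

/-- How far the fuzzy set `f` is from being invariant under translation by `s`. -/
def shiftDefect (f : ℕ → ℝ) (N s : ℕ) : ℝ := ∑ j ∈ range N, f j * (1 - f (j + s))

theorem sum_range_shift_le {g : ℕ → ℝ} (hg : ∀ i, 0 ≤ g i) (N s : ℕ) :
    ∑ j ∈ range N, g (j + s) ≤ ∑ j ∈ range N, g j + ∑ x ∈ range s, g (N + x) := by
  rw [← sum_range_add]
  have h : ∑ j ∈ range N, g (j + s) = ∑ i ∈ (range N).map (addRightEmbedding s), g i := by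
    rw [sum_map]; rfl
  rw [h]
  refine sum_le_sum_of_subset_of_nonneg ?_ fun i _ _ => hg i
  intro i
  simp only [mem_map, mem_range, addRightEmbedding_apply]
  rintro ⟨j, hj, rfl⟩
  omega

variable {f : ℕ → ℝ} {N : ℕ}

/-- For independent events of probabilities a, b, c: if the first occurs and the third fails, then
either the second fails with the first occurring, or it occurs with the third failing. -/
theorem mul_one_sub_triangle {a b c : ℝ} (ha0 : 0 ≤ a) (ha1 : a ≤ 1) (hb0 : 0 ≤ b) (hb1 : b ≤ 1)
    (hc0 : 0 ≤ c) (hc1 : c ≤ 1) : a * (1 - c) ≤ a * (1 - b) + b * (1 - c) := by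
  nlinarith [mul_nonneg (mul_nonneg hb0 (sub_nonneg.2 ha1)) (sub_nonneg.2 hc1),
    mul_nonneg (mul_nonneg ha0 hc0) (sub_nonneg.2 hb1)]

/-- Shift by s, then by t, and use the triangle inequality. Points pushed past N cost nothing
because f = 1 there. -/
theorem shiftDefect_add_le (h0 : ∀ j, 0 ≤ f j) (h1 : ∀ j, f j ≤ 1) (hN : ∀ j, N ≤ j → f j = 1)
    (s t : ℕ) : shiftDefect f N (s + t) ≤ shiftDefect f N s + shiftDefect f N t := by
  have h2 := sum_range_shift_le (g := fun i => f i * (1 - f (i + t)))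
    (fun i => mul_nonneg (h0 _) (sub_nonneg.2 (h1 _))) N s
  have h3 : ∑ x ∈ range s, f (N + x) * (1 - f (N + x + t)) = 0 :=
    sum_eq_zero fun x _ => by rw [hN (N + x + t) (by omega)]; ring
  simp only [h3, add_zero] at h2
  refine le_trans ?_ (add_le_add_right h2 _)
  unfold shiftDefect
  rw [← sum_add_distrib]
  refine sum_le_sum fun j _ => ?_
  rw [← add_assoc]
  exact mul_one_sub_triangle (h0 _) (h1 _) (h0 _) (h1 _) (h0 _) (h1 _)

/-- Go forward by t + s and back by s. Reversing the shift by s replaces f(1 − f(· + s)) by f(· +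
s)(1 − f), and the two sums differ by at most the boundary mass s. -/
theorem shiftDefect_le_add (h0 : ∀ j, 0 ≤ f j) (h1 : ∀ j, f j ≤ 1) (hN : ∀ j, N ≤ j → f j = 1)
    (s t : ℕ) : shiftDefect f N t ≤ shiftDefect f N (t + s) + shiftDefect f N s + s := by
  have h2 := sum_range_shift_le (g := fun i => f (i + s) * (1 - f i))
    (fun i => mul_nonneg (h0 _) (sub_nonneg.2 (h1 _))) N t
  have h3 : ∑ x ∈ range t, f (N + x + s) * (1 - f (N + x)) = 0 :=
    sum_eq_zero fun x _ => by rw [hN (N + x) (by omega)]; ring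
  simp only [h3, add_zero] at h2
  have h4 := sum_range_shift_le h0 N s
  have h5 : ∑ x ∈ range s, f (N + x) ≤ s := by
    simpa using sum_le_card_nsmul (range s) (fun x => f (N + x)) 1 (fun x _ => h1 _)
  have h6 : ∑ j ∈ range N, f (j + s) * (1 - f j) =
      shiftDefect f N s + (∑ j ∈ range N, f (j + s) - ∑ j ∈ range N, f j) := by
    unfold shiftDefect
    rw [← sum_sub_distrib, ← sum_add_distrib]
    exact sum_congr rfl fun j _ => by ring
  have h7 : shiftDefect f N t ≤ shiftDefect f N (t + s) +
      ∑ j ∈ range N, f (j + t + s) * (1 - f (j + t)) := by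
    unfold shiftDefect
    rw [← sum_add_distrib]
    refine sum_le_sum fun j _ => ?_
    rw [← add_assoc]
    exact mul_one_sub_triangle (h0 _) (h1 _) (h0 _) (h1 _) (h0 _) (h1 _)
  linarith

/-- If all shifts from a dense subset of `[0, M)`, as well as the shift by `1`, have small defect,
then all shifts from `[0, M]` have small defect. -/
theorem shiftDefect_le_of_dense (h0 : ∀ j, 0 ≤ f j) (h1 : ∀ j, f j ≤ 1)
    (hN : ∀ j, N ≤ j → f j = 1) {M : ℕ} (hM : 0 < M) {V : Finset ℕ} (hVM : ∀ v ∈ V, v < M)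
    {ρ κ : ℝ} (hρ : 0 < ρ) (hcard : ρ * M ≤ #V) (hV : ∀ v ∈ V, shiftDefect f N v ≤ κ)
    (hV1 : shiftDefect f N 1 ≤ κ) {s : ℕ} (hs : s ≤ M) :
    shiftDefect f N s ≤ 4 / ρ * (2 * κ + M) := by
  classical
  by_contra! hlt
  have hMR : (0 : ℝ) < M := by exact_mod_cast hM
  have hVne : V.Nonempty := by
    rw [← card_pos]
    have : (0 : ℝ) < #V := lt_of_lt_of_le (by positivity) hcard
    exact_mod_cast this
  have hDnn : ∀ t, 0 ≤ shiftDefect f N t := fun t =>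
    sum_nonneg fun j _ => mul_nonneg (h0 _) (sub_nonneg.2 (h1 _))
  have hκ : 0 ≤ κ := (hDnn 1).trans hV1
  set τ : ℝ := 2 * κ + M with hτ
  have hτ0 : 0 < τ := by positivity
  set K := ⌊2 / ρ⌋₊ with hK
  have hK1 : (K : ℝ) ≤ 2 / ρ := Nat.floor_le (by positivity)
  have hK2 : 2 / ρ < K + 1 := Nat.lt_floor_add_one _
  -- first crossing points
  have hex : ∀ m : ℕ, ∃ x, m ≤ K → x ≤ M ∧ 2 * m * τ < shiftDefect f N x ∧
      shiftDefect f N x ≤ 2 * m * τ + τ := by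
    intro m
    by_cases hm : m ≤ K
    swap
    · exact ⟨0, fun h => absurd h hm⟩
    have hm' : (m : ℝ) ≤ K := by exact_mod_cast hm
    have hsm : ∃ x, 2 * m * τ < shiftDefect f N x := by
      refine ⟨s, lt_of_le_of_lt ?_ hlt⟩
      have : 2 * (m : ℝ) ≤ 4 / ρ := by
        have : 4 / ρ = 2 * (2 / ρ) := by ring
        linarith
      exact mul_le_mul_of_nonneg_right this hτ0.le
    refine ⟨Nat.find hsm, fun _ => ⟨?_, Nat.find_spec hsm, ?_⟩⟩
    · refine le_trans (Nat.find_min' hsm (lt_of_le_of_lt ?_ hlt)) hs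
      have : 2 * (m : ℝ) ≤ 4 / ρ := by
        have : 4 / ρ = 2 * (2 / ρ) := by ring
        linarith
      exact mul_le_mul_of_nonneg_right this hτ0.le
    · rcases Nat.eq_zero_or_pos (Nat.find hsm) with hz | hp
      · rw [hz]
        obtain ⟨v, hv⟩ := hVne
        have h2 := shiftDefect_le_add h0 h1 hN v 0
        rw [zero_add] at h2
        have h3 := hV v hv
        have h4 : (v : ℝ) ≤ M := by exact_mod_cast (hVM v hv).le
        have h5 : 0 ≤ 2 * (m : ℝ) * τ := by positivity
        linarith
      · have h2 := Nat.find_min hsm (m := Nat.find hsm - 1) (by omega)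
        have h3 := shiftDefect_add_le h0 h1 hN (Nat.find hsm - 1) 1
        rw [Nat.sub_add_cancel hp] at h3
        linarith
  choose x hx using hex
  -- A coincidence x m + v = x m' + v' would give D(x m') ≤ D(x m) + 2κ + M ≤ (2m + 2)τ. So the K +
  -- 1 translates of V are disjoint in [0, 2M), which is too small as (K + 1)ρ > 2.
  have hdisj : ∀ m m', m < m' → m' ≤ K → ∀ v ∈ V, ∀ v' ∈ V, x m + v ≠ x m' + v' := by
    intro m m' hmm hm' v hv v' hv' heq
    have h2 := shiftDefect_le_add h0 h1 hN v' (x m')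
    rw [← heq] at h2
    have h3 := shiftDefect_add_le h0 h1 hN (x m) v
    have h4 := (hx m (by omega)).2.2
    have h5 := (hx m' hm').2.1
    have h6 : (v' : ℝ) ≤ M := by exact_mod_cast (hVM v' hv').le
    have h7 := hV v hv
    have h8 := hV v' hv'
    have h9 : (m : ℝ) + 1 ≤ m' := by exact_mod_cast hmm
    nlinarith
  have hcardU : #((range (K + 1)).biUnion fun m => V.map (addLeftEmbedding (x m))) =
      (K + 1) * #V := by
    rw [card_biUnion]
    · simp
    · intro m hm m' hm' hne
      rw [mem_coe, mem_range] at hm hm'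
      rw [Function.onFun, disjoint_left]
      simp only [mem_map, addLeftEmbedding_apply]
      rintro y ⟨v, hv, rfl⟩ ⟨v', hv', heq⟩
      rcases lt_or_gt_of_ne hne with hlt' | hlt'
      · exact hdisj m m' hlt' (by omega) v hv v' hv' heq.symm
      · exact hdisj m' m hlt' (by omega) v' hv' v hv heq
  have hsub : ((range (K + 1)).biUnion fun m => V.map (addLeftEmbedding (x m))) ⊆
      range (2 * M) := by
    intro y
    simp only [mem_biUnion, mem_range, mem_map, addLeftEmbedding_apply]
    rintro ⟨m, hm, v, hv, rfl⟩
    have h2 := (hx m (by omega)).1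
    have h3 := hVM v hv
    omega
  have h2 := card_le_card hsub
  rw [hcardU, card_range] at h2
  have h3 : ((K : ℝ) + 1) * #V ≤ 2 * M := by exact_mod_cast h2
  have h4 : 2 < (K + 1) * ρ := by rwa [div_lt_iff₀ hρ] at hK2
  have h5 : ((K : ℝ) + 1) * (ρ * M) ≤ (K + 1) * #V :=
    mul_le_mul_of_nonneg_left hcard (by positivity)
  nlinarith

/-- Substitute t = j + s; terms with t ≥ N vanish. -/
theorem sum_shiftDefect (hN : ∀ j, N ≤ j → f j = 1) :
    ∑ s ∈ range N, shiftDefect f N s =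
      ∑ t ∈ range N, (1 - f t) * ∑ j ∈ range (t + 1), f j := by
  have h1 : ∀ s ∈ range N, shiftDefect f N s =
      ∑ j ∈ range N, ∑ t ∈ range N, if j + s = t then f j * (1 - f t) else 0 := by
    intro s _
    refine sum_congr rfl fun j _ => ?_
    rw [sum_ite_eq]
    split_ifs with h
    · rfl
    · rw [hN (j + s) (by simpa using h)]; ring
  rw [sum_congr rfl h1, sum_comm]
  have h2 : ∀ j ∈ range N, (∑ s ∈ range N, ∑ t ∈ range N,
      if j + s = t then f j * (1 - f t) else 0) =
      ∑ t ∈ range N, if j ≤ t then f j * (1 - f t) else 0 := by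
    intro j _
    rw [sum_comm]
    refine sum_congr rfl fun t ht => ?_
    rw [mem_range] at ht
    split_ifs with h
    · rw [sum_eq_single (t - j)]
      · rw [if_pos (by omega)]
      · intro s _ hs
        rw [if_neg (by omega)]
      · intro hs
        rw [mem_range] at hs
        omega
    · exact sum_eq_zero fun s _ => if_neg (by omega)
  rw [sum_congr rfl h2, sum_comm]
  refine sum_congr rfl fun t ht => ?_
  rw [mem_range] at ht
  rw [mul_sum, ← sum_filter]
  have : ({j ∈ range N | j ≤ t} : Finset ℕ) = range (t + 1) := by
    ext j; simp only [mem_filter, mem_range]; omega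
  rw [this]
  exact sum_congr rfl fun j _ => by ring

/-- Split the sum into its part from V and its part e from short steps. The extra κ pays for the
shift by 0, whose defect Σ f(1 − f) need not vanish. -/
theorem shiftDefect_of_mem_sumsOf (h0 : ∀ j, 0 ≤ f j) (h1 : ∀ j, f j ≤ 1)
    (hN : ∀ j, N ≤ j → f j = 1) {V : Finset ℕ} {κ : ℝ} (hV : ∀ v ∈ V, shiftDefect f N v ≤ κ)
    (hV0 : 0 ∈ V) {L k s : ℕ} (hs : s ∈ sumsOf {x | x ∈ V ∨ x ≤ L} k) :
    ∃ e ≤ k * L, shiftDefect f N s ≤ (k + 1) * κ + shiftDefect f N e := by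
  suffices h : ∃ t, ∃ e ≤ k * L, s = t + e ∧ shiftDefect f N t ≤ (k + 1) * κ by
    obtain ⟨t, e, he, rfl, ht⟩ := h
    exact ⟨e, he, (shiftDefect_add_le h0 h1 hN t e).trans (by linarith)⟩
  have hκ : 0 ≤ κ := le_trans
    (sum_nonneg fun j _ => mul_nonneg (h0 _) (sub_nonneg.2 (h1 _))) (hV 0 hV0)
  induction k generalizing s with
  | zero =>
    obtain rfl : s = 0 := hs
    exact ⟨0, 0, by simp, by simp, by simpa using hV 0 hV0⟩
  | succ k ih =>
    obtain ⟨a, ha, b, hb, rfl⟩ := hs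
    obtain ⟨t, e, he, rfl, ht⟩ := ih ha
    rcases hb with hb | hb
    · refine ⟨t + b, e, by nlinarith, by ring, ?_⟩
      have := shiftDefect_add_le h0 h1 hN t b
      have := hV b hb
      push_cast
      linarith
    · refine ⟨t, e + b, by nlinarith, by ring, ?_⟩
      push_cast
      linarith

end ShiftDefect

/-! ### All shifts have small defect, and the contradiction -/

section ShiftDefect

open Finset

variable {f : ℕ → ℝ} {N : ℕ}

/-- V may be sparse below Nδ, so [0, Nδ] is added to make a Schnirelmann basis. The total shift e
contributed by the added elements is O(δN/ε), and V is dense on that scale, so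
`shiftDefect_le_of_dense` applies to it. -/
theorem shiftDefect_le_of_density (h0 : ∀ j, 0 ≤ f j) (h1 : ∀ j, f j ≤ 1)
    (hN : ∀ j, N ≤ j → f j = 1) {ε δ : ℝ} (hε : 0 < ε) (hε1 : ε ≤ 1) (hδ : 0 < δ)
    (hδε : 10 * δ ≤ ε) {V : Finset ℕ}
    (hdens : ∀ i : ℕ, N * δ ≤ i → i ≤ N → ε / 2 * i ≤ #{v ∈ V | v < i})
    (hV : ∀ v ∈ V, shiftDefect f N v ≤ 2 * δ * N) (hV0 : 0 ∈ V) (hV1 : 1 < N → 1 ∈ V)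
    {s : ℕ} (hs : s < N) : shiftDefect f N s ≤ 134 * δ * N / ε ^ 2 := by
  classical
  have hNR : (0 : ℝ) < N := by exact_mod_cast (by omega : 0 < N)
  have hx : 0 < δ * N := by positivity
  have hinv : 1 ≤ 1 / ε := by rw [le_div_iff₀ hε]; linarith
  have hinv2 : 1 / ε ≤ (1 / ε) ^ 2 := by nlinarith
  have hgoal : 134 * δ * N / ε ^ 2 = 134 * (δ * N) * (1 / ε) ^ 2 := by field_simp
  rw [hgoal]
  set r := 1 / ε with hr
  rcases Nat.lt_or_ge 1 N with hN1 | hN1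
  swap
  · obtain rfl : s = 0 := by omega
    have := hV 0 hV0
    nlinarith
  have hV1 := hV1 hN1
  set L := ⌊N * δ⌋₊ with hL
  have hL1 : (L : ℝ) ≤ N * δ := Nat.floor_le (by positivity)
  have hL2 : N * δ < L + 1 := Nat.lt_floor_add_one _
  set W : Set ℕ := {x | x ∈ V ∨ x ≤ L} with hW
  have hWd : ∀ n, n < N → ε / 4 * n ≤ #{x ∈ Icc 1 n | x ∈ W} := by
    intro n hn
    rcases le_or_gt n L with hnL | hnL
    · have : ({x ∈ Icc 1 n | x ∈ W} : Finset ℕ) = Icc 1 n := by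
        apply filter_true_of_mem
        intro x hx
        exact Or.inr ((mem_Icc.1 hx).2.trans hnL)
      rw [this, Nat.card_Icc, Nat.add_sub_cancel]
      have : (0 : ℝ) ≤ n := Nat.cast_nonneg n
      nlinarith
    · have h2 : (L : ℝ) + 1 ≤ n := by exact_mod_cast hnL
      have h3 := hdens n (by linarith) hn.le
      -- Counting from 1 loses the element 0. Since 1 ∈ W the count is at least 1, so this at most
      -- halves the density: hence ε/4.
      have h4 : #{v ∈ V | v < n} ≤ #{x ∈ Icc 1 n | x ∈ W} + 1 := by
        refine le_trans (card_le_card ?_) (card_insert_le 0 _)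
        intro v
        simp only [mem_filter, mem_insert, mem_Icc]
        rintro ⟨hv, hvn⟩
        rcases Nat.eq_zero_or_pos v with h | h
        · exact Or.inl h
        · exact Or.inr ⟨⟨h, hvn.le⟩, Or.inl hv⟩
      have h5 : 1 ≤ #{x ∈ Icc 1 n | x ∈ W} := by
        rw [Nat.one_le_iff_ne_zero, ← Nat.pos_iff_ne_zero, card_pos]
        exact ⟨1, mem_filter.2 ⟨mem_Icc.2 ⟨le_rfl, by omega⟩, Or.inl hV1⟩⟩
      have h4' : (#{v ∈ V | v < n} : ℝ) ≤ #{x ∈ Icc 1 n | x ∈ W} + 1 := by exact_mod_cast h4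
      have h5' : (1 : ℝ) ≤ #{x ∈ Icc 1 n | x ∈ W} := by exact_mod_cast h5
      linarith
  have hsW := mem_sumsOf_of_density (W := W) (Or.inl hV0) (by positivity) (by linarith) hWd hs
  set m := ⌈1 / (ε / 4)⌉₊ with hm
  have hm1 : 1 ≤ m := Nat.one_le_ceil_iff.2 (by positivity)
  have hm2 : (m : ℝ) ≤ 5 * r := by
    have h2 := (Nat.ceil_lt_add_one (a := 1 / (ε / 4)) (by positivity)).le
    have h3 : 1 / (ε / 4) = 4 * r := by rw [hr]; field_simp
    rw [← hm, h3] at h2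
    linarith
  obtain ⟨e, he, hse⟩ := shiftDefect_of_mem_sumsOf h0 h1 hN hV hV0 hsW
  -- With κ = 2δN and M ≤ 10rδN, the bound 8r(2κ + M) is at most 112r²δN; the steps from V add at
  -- most 11r · 2δN, for a total of 134r²δN.
  have he' : shiftDefect f N e ≤ 112 * (δ * N) * r ^ 2 := by
    rcases Nat.eq_zero_or_pos L with hz | hp
    · obtain rfl : e = 0 := by rw [hz] at he; omega
      have := hV 0 hV0
      nlinarith
    · set M := (m + m) * L with hM
      have hMpos : 0 < M := by positivity
      have hML : 2 * L ≤ M := by rw [hM]; nlinarith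
      have hML' : (2 : ℝ) * L ≤ M := by exact_mod_cast hML
      have hp' : (1 : ℝ) ≤ L := by exact_mod_cast hp
      have hMr : (M : ℝ) ≤ 10 * r * (δ * N) := by
        rw [hM]
        push_cast
        have h2 : (m : ℝ) + m ≤ 10 * r := by linarith
        have h3 : (L : ℝ) ≤ δ * N := by linarith
        exact mul_le_mul h2 h3 (by positivity) (by positivity)
      have hMN : M ≤ N := by
        have h2 : 10 * δ * r ≤ 1 := by
          rw [hr, mul_one_div, div_le_one hε]; exact hδε
        have h3 : (M : ℝ) ≤ N := by nlinarith
        exact_mod_cast h3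
      have h2 := shiftDefect_le_of_dense h0 h1 hN hMpos (V := {v ∈ V | v < M})
        (fun v hv => (mem_filter.1 hv).2) (ρ := ε / 2) (by positivity)
        (hdens M (by linarith) hMN) (fun v hv => hV v (mem_filter.1 hv).1) (hV 1 hV1) he
      have h3 : 4 / (ε / 2) = 8 * r := by rw [hr]; field_simp; norm_num
      rw [h3] at h2
      nlinarith
  push_cast at hse
  have h2 : ((m : ℝ) + m + 1) * (2 * δ * N) ≤ 11 * r * (2 * δ * N) :=
    mul_le_mul_of_nonneg_right (by linarith) (by positivity)
  nlinarith

/-- The set of levels of a would-be non-expanding set cannot be dense, co-dense and closed under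
addition of its elements up to small errors. -/
theorem false_of_shiftDefect_small (hNpos : 0 < N) (h0 : ∀ j, 0 ≤ f j) (h1 : ∀ j, f j ≤ 1)
    (hN : ∀ j, N ≤ j → f j = 1) {ε δ : ℝ} (hε : 0 < ε) (hε1 : ε ≤ 1) (hδ : δ = ε ^ 5 / 2000)
    {V : Finset ℕ} (hdens : ∀ i : ℕ, N * δ ≤ i → i ≤ N → ε / 2 * i ≤ #{v ∈ V | v < i})
    (hV : ∀ v ∈ V, shiftDefect f N v ≤ 2 * δ * N) (hV0 : 0 ∈ V) (hV1 : 1 < N → 1 ∈ V)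
    (htot : ∑ j ∈ range N, f j ≤ N * (1 - ε))
    (hinit : ∀ i : ℕ, N * δ ≤ i → i ≤ N → ε / 2 * i - 2 * δ * N ≤ ∑ j ∈ range i, f j) :
    False := by
  have hNR : (0 : ℝ) < N := by exact_mod_cast hNpos
  have hδ0 : 0 < δ := by rw [hδ]; positivity
  have hε5 : ε ^ 5 ≤ ε := by
    simpa using pow_le_pow_of_le_one hε.le hε1 (show 1 ≤ 5 by norm_num)
  have hε53 : ε ^ 5 ≤ ε ^ 3 := pow_le_pow_of_le_one hε.le hε1 (by norm_num)
  have hup : ∑ s ∈ range N, shiftDefect f N s ≤ N * (134 * δ * N / ε ^ 2) := by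
    have := sum_le_card_nsmul (range N) (shiftDefect f N) _ fun s hs =>
      shiftDefect_le_of_density h0 h1 hN hε hε1 hδ0 (by rw [hδ]; linarith) hdens hV hV0 hV1
        (mem_range.1 hs)
    simpa using this
  rw [sum_shiftDefect hN] at hup
  have hlow : ∀ t ∈ range N, ε / 2 * ((1 - f t) * (t + 1)) - 2 * δ * N ≤
      (1 - f t) * ∑ j ∈ range (t + 1), f j := by
    intro t ht
    have ht' := mem_range.1 ht
    have hft := sub_nonneg.2 (h1 t)
    have hft1 : 1 - f t ≤ 1 := by linarith [h0 t]
    have hS : 0 ≤ ∑ j ∈ range (t + 1), f j := sum_nonneg fun j _ => h0 j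
    have hx : 0 < 2 * δ * N := by positivity
    have h2 : ε / 2 * (t + 1) - 2 * δ * N ≤ ∑ j ∈ range (t + 1), f j := by
      rcases le_or_gt (N * δ) ((t + 1 : ℕ) : ℝ) with h | h
      · have := hinit (t + 1) h (by omega)
        push_cast at this
        exact this
      · push_cast at h
        nlinarith
    nlinarith [mul_le_mul_of_nonneg_left h2 hft, mul_le_mul_of_nonneg_right hft1 hx.le]
  have hlow' := sum_le_sum hlow
  rw [sum_sub_distrib, ← mul_sum, sum_const, card_range, nsmul_eq_mul] at hlow'
  set θ : ℝ := ε * N / 2 with hθ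
  have hθ0 : 0 < θ := by positivity
  -- The missing mass Σ(1 − f) is at least εN = 2θ. At most θ of it sits at t + 1 ≤ θ, and the rest
  -- has weight at least θ, which yields θ².
  have hpt : ∀ t ∈ range N, θ * (1 - f t) - (if (t : ℝ) + 1 ≤ θ then θ else 0) ≤
      (1 - f t) * (t + 1) := by
    intro t _
    have hft := sub_nonneg.2 (h1 t)
    have hft1 : 1 - f t ≤ 1 := by linarith [h0 t]
    have ht0 : (0 : ℝ) ≤ t := Nat.cast_nonneg t
    split_ifs with h
    · nlinarith
    · push Not at h
      nlinarith
  have hpt' := sum_le_sum hpt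
  rw [sum_sub_distrib, ← mul_sum, ← sum_filter, sum_const, nsmul_eq_mul, sum_sub_distrib] at hpt'
  have hcard : (#{t ∈ range N | ((t : ℕ) : ℝ) + 1 ≤ θ} : ℝ) ≤ θ := by
    have h2 : #{t ∈ range N | ((t : ℕ) : ℝ) + 1 ≤ θ} ≤ ⌊θ⌋₊ := by
      rw [← card_range ⌊θ⌋₊]
      apply card_le_card
      intro t
      simp only [mem_filter, mem_range]
      rintro ⟨-, h⟩
      have : t + 1 ≤ ⌊θ⌋₊ := Nat.le_floor (by push_cast; exact h)
      omega
    exact (Nat.cast_le.2 h2).trans (Nat.floor_le hθ0.le)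
  have hone : ∑ t ∈ range N, (1 : ℝ) = N := by simp
  rw [hone] at hpt'
  have h2 : θ * θ ≤ ∑ t ∈ range N, (1 - f t) * ((t : ℝ) + 1) := by
    have h3 : 2 * θ ≤ N - ∑ t ∈ range N, f t := by rw [hθ]; linarith
    have h4 := mul_le_mul_of_nonneg_left h3 hθ0.le
    have h5 := mul_le_mul_of_nonneg_right hcard hθ0.le
    linarith
  have h3 : ε / 2 * (θ * θ) - N * (2 * δ * N) ≤ N * (134 * δ * N / ε ^ 2) := by
    have := mul_le_mul_of_nonneg_left h2 (by positivity : 0 ≤ ε / 2)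
    linarith
  have h4 : N * (134 * δ * N / ε ^ 2) = 134 / 2000 * ε ^ 3 * (N : ℝ) ^ 2 := by
    rw [hδ]; field_simp
  have h5 : ε / 2 * (θ * θ) = 1 / 8 * ε ^ 3 * (N : ℝ) ^ 2 := by rw [hθ]; ring
  have h6 : N * (2 * δ * N) ≤ 2 / 2000 * ε ^ 3 * (N : ℝ) ^ 2 := by
    rw [hδ]
    have := mul_le_mul_of_nonneg_right hε53 (by positivity : 0 ≤ (N : ℝ) ^ 2)
    nlinarith
  have h7 : 0 < ε ^ 3 * (N : ℝ) ^ 2 := by positivity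
  rw [h4, h5] at h3
  nlinarith

end ShiftDefect

/-! ### Entropy through fibre sizes -/

section FiberCard

open Finset

variable {α β κ γ : Type*} [Fintype α]

open Classical in
/-- The number of points with the same image as `a`. -/
noncomputable def fiberCard (f : α → β) (a : α) : ℕ := #{a' | f a' = f a}

theorem fiberCard_pos (f : α → β) (a : α) : 0 < fiberCard f a := by
  classical
  unfold fiberCard
  rw [card_pos]
  exact ⟨a, by simp⟩

theorem fiberCard_pos' (f : α → β) (a : α) : (0 : ℝ) < fiberCard f a := by
  exact_mod_cast fiberCard_pos f a

theorem fiberCard_congr {f : α → β} {g : α → γ} (h : ∀ a a', f a = f a' ↔ g a = g a') (a : α) :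
    fiberCard f a = fiberCard g a := by
  classical
  unfold fiberCard
  simp only [h]

theorem fiberCard_mono {f : α → β} {g : α → γ} (h : ∀ a a', f a = f a' → g a = g a') (a : α) :
    fiberCard f a ≤ fiberCard g a := by
  classical
  unfold fiberCard
  exact card_le_card fun x hx => by simpa using h _ _ (by simpa using hx)

theorem fiberCard_of_subsingleton [Subsingleton β] (f : α → β) (a : α) :
    fiberCard f a = Fintype.card α := by
  classical
  unfold fiberCard
  rw [← card_univ]
  congr 1
  ext x
  simp only [mem_filter, mem_univ, true_and, iff_true]
  exact Subsingleton.elim _ _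

theorem fiberCard_eq_sum (f : α → β) (a : α) [DecidableEq β] :
    (fiberCard f a : ℝ) = ∑ x, if f a = f x then 1 else 0 := by
  unfold fiberCard
  rw [sum_boole]
  congr 2
  ext x
  simp only [mem_filter, mem_univ, true_and]
  exact eq_comm

theorem sum_inv_card_fiber {α β : Type*} [DecidableEq β] (s : Finset α) (f : α → β) :
    ∑ a ∈ s, (1 : ℝ) / #{a' ∈ s | f a' = f a} = #(s.image f) := by
  rw [sum_comp (fun b => (1 : ℝ) / #{a' ∈ s | f a' = b}) f, card_eq_sum_ones]
  push_cast
  refine sum_congr rfl fun b hb => ?_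
  obtain ⟨a, ha, rfl⟩ := mem_image.1 hb
  have : (0 : ℝ) < #{a' ∈ s | f a' = f a} := by
    exact_mod_cast card_pos.2 ⟨a, by simp [ha]⟩
  rw [nsmul_eq_mul, mul_one_div_cancel this.ne']

/-- The entropy of the uniform distribution pushed forward by `f` is at most the logarithm of the
size of a set containing the image. -/
theorem log_card_le_sum_log_fiberCard [Nonempty α] (f : α → β) (S : Finset β)
    (hS : ∀ a, f a ∈ S) : Fintype.card α * Real.log (Fintype.card α) -
      ∑ a, Real.log (fiberCard f a) ≤ Fintype.card α * Real.log #S := by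
  classical
  have hn : (0 : ℝ) < Fintype.card α := by exact_mod_cast Fintype.card_pos
  have hSpos : (0 : ℝ) < #S := by
    obtain ⟨a⟩ := ‹Nonempty α›
    exact_mod_cast card_pos.2 ⟨_, hS a⟩
  have h1 : ∀ a ∈ (univ : Finset α), Real.log (Fintype.card α) - Real.log (fiberCard f a) -
      Real.log #S ≤ Fintype.card α / #S * (1 / fiberCard f a) - 1 := by
    intro a _
    have hc := fiberCard_pos' f a
    rw [← Real.log_div hn.ne' hc.ne', ← Real.log_div (by positivity) hSpos.ne']
    refine (Real.log_le_sub_one_of_pos (by positivity)).trans_eq ?_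
    field_simp
  have h2 := sum_le_sum h1
  have h3 : ∑ a, (1 : ℝ) / fiberCard f a = #(univ.image f) := by
    rw [← sum_inv_card_fiber]
    rfl
  have h4 : (#(univ.image f) : ℝ) ≤ #S := by
    exact_mod_cast card_le_card fun b hb => by
      obtain ⟨a, -, rfl⟩ := mem_image.1 hb
      exact hS a
  simp only [sum_sub_distrib, ← mul_sum, h3, sum_const, card_univ, nsmul_eq_mul, mul_one] at h2
  have h5 : Fintype.card α / (#S : ℝ) * #(univ.image f) ≤ Fintype.card α := by
    rw [div_mul_eq_mul_div, div_le_iff₀ hSpos]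
    exact mul_le_mul_of_nonneg_left h4 hn.le
  linarith

/-- Submodularity of entropy. -/
theorem sum_log_fiberCard_submodular (f : α → β) (k : α → κ) (g : α → γ) (gf : β → γ) (gk : κ → γ)
    (hf : ∀ a, g a = gf (f a)) (hk : ∀ a, g a = gk (k a)) :
    ∑ a, Real.log (fiberCard f a) + ∑ a, Real.log (fiberCard k a) ≤
      ∑ a, Real.log (fiberCard (fun a => (f a, k a)) a) + ∑ a, Real.log (fiberCard g a) := by
  classical
  set fk : α → β × κ := fun a => (f a, k a) with hfk
  have h1 : ∀ a ∈ (univ : Finset α), Real.log (fiberCard f a) + Real.log (fiberCard k a) -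
      Real.log (fiberCard fk a) - Real.log (fiberCard g a) ≤
      (fiberCard f a * fiberCard k a) * (1 / (fiberCard fk a * fiberCard g a)) - 1 := by
    intro a _
    have h1 := fiberCard_pos' f a
    have h2 := fiberCard_pos' k a
    have h3 := fiberCard_pos' fk a
    have h4 := fiberCard_pos' g a
    rw [← Real.log_mul h1.ne' h2.ne', ← Real.log_div (by positivity) h3.ne',
      ← Real.log_div (by positivity) h4.ne']
    refine (Real.log_le_sub_one_of_pos (by positivity)).trans_eq ?_
    field_simp
  have h2 := sum_le_sum h1
  simp only [sum_sub_distrib, sum_add_distrib, sum_const, card_univ, nsmul_eq_mul,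
    mul_one] at h2
  have hexp : ∀ a, ((fiberCard f a * fiberCard k a : ℝ)) * (1 / (fiberCard fk a * fiberCard g a)) =
      ∑ x, ∑ y, if f a = f x ∧ k a = k y then
        (1 : ℝ) / (fiberCard fk a * fiberCard g a) else 0 := by
    intro a
    rw [fiberCard_eq_sum f, fiberCard_eq_sum k, sum_mul_sum, sum_mul]
    refine sum_congr rfl fun x _ => ?_
    rw [sum_mul]
    refine sum_congr rfl fun y _ => ?_
    by_cases h1 : f a = f x <;> by_cases h2 : k a = k y <;> simp [h1, h2]
  -- The points a compatible with (x, y) form a single fibre of (f, k), on which the summand is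
  -- constant, or there are none.
  have hin : ∀ x y, (∑ a, if f a = f x ∧ k a = k y then
        (1 : ℝ) / (fiberCard fk a * fiberCard g a) else 0) ≤
      if g x = g y then 1 / (fiberCard g y : ℝ) else 0 := by
    intro x y
    by_cases hex : ∃ a₀, f a₀ = f x ∧ k a₀ = k y
    · obtain ⟨a₀, hx, hy⟩ := hex
      have hgx : g a₀ = g x := by rw [hf, hf, hx]
      have hgy : g a₀ = g y := by rw [hk, hk, hy]
      rw [if_pos (hgx.symm.trans hgy), ← sum_filter]
      have hterm : ∀ a ∈ ({a | f a = f x ∧ k a = k y} : Finset α),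
          (1 : ℝ) / (fiberCard fk a * fiberCard g a) =
            1 / (fiberCard fk a₀ * fiberCard g y) := by
        intro a ha
        simp only [mem_filter, mem_univ, true_and] at ha
        have e1 : fk a = fk a₀ := by simp only [hfk, ha.1, ha.2, hx, hy]
        have e2 : g a = g y := by rw [hk, hk, ha.2]
        unfold fiberCard
        rw [e1, e2]
      have hcard : #({a | f a = f x ∧ k a = k y} : Finset α) = fiberCard fk a₀ := by
        unfold fiberCard
        congr 1
        ext a
        simp [hfk, hx, hy]
      rw [sum_congr rfl hterm, sum_const, hcard, nsmul_eq_mul]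
      have h3 := fiberCard_pos' fk a₀
      have h4 := fiberCard_pos' g y
      apply le_of_eq
      field_simp
    · rw [sum_eq_zero]
      · split_ifs <;> positivity
      · intro a _
        exact if_neg fun h => hex ⟨a, h⟩
  have htot : ∑ a, ((fiberCard f a * fiberCard k a : ℝ)) *
      (1 / (fiberCard fk a * fiberCard g a)) ≤ Fintype.card α := by
    rw [sum_congr rfl fun a _ => hexp a, sum_comm]
    have h3 : ∀ x ∈ (univ : Finset α), (∑ a, ∑ y, if f a = f x ∧ k a = k y then
        (1 : ℝ) / (fiberCard fk a * fiberCard g a) else 0) ≤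
        ∑ y, if g x = g y then 1 / (fiberCard g y : ℝ) else 0 := by
      intro x _
      rw [sum_comm]
      exact sum_le_sum fun y _ => hin x y
    refine (sum_le_sum h3).trans ?_
    rw [sum_comm]
    have h4 : ∀ y ∈ (univ : Finset α),
        (∑ x, if g x = g y then 1 / (fiberCard g y : ℝ) else 0) = 1 := by
      intro y _
      rw [← sum_filter, sum_const, nsmul_eq_mul]
      exact mul_one_div_cancel (fiberCard_pos' g y).ne'
    rw [sum_congr rfl h4]
    simp
  linarith

end FiberCard

/-! ### Digits and their information -/

section Levels

open Finset

/-- Here x and y are conditional probabilities of the next digits, and xy + 1/(q − 1) bounds the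
mean collision probability over ω. It is at most 4 max(xy, 1/q), and 1 − (1 − s)(1 − t) ≤ min(1, s +
t) for s, t in [0,1]. -/
theorem one_sub_mul_one_sub_le_neg_log {q : ℕ} (hq : 2 ≤ q) {x y : ℝ} (hx : 0 < x) (hx1 : x ≤ 1)
    (hy : 0 < y) (hy1 : y ≤ 1) :
    Real.log q * (1 - (1 - min 1 (-Real.log x / Real.log q)) *
      (1 - min 1 (-Real.log y / Real.log q))) - Real.log 4 ≤
      -Real.log (x * y + 1 / (q - 1)) := by
  have hqR : (2 : ℝ) ≤ q := by exact_mod_cast hq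
  have hL : 0 < Real.log q := Real.log_pos (by linarith)
  set l := Real.log q with hl
  have hs0 : 0 ≤ -Real.log x / l := div_nonneg (neg_nonneg.2 (Real.log_nonpos hx.le hx1)) hL.le
  have ht0 : 0 ≤ -Real.log y / l := div_nonneg (neg_nonneg.2 (Real.log_nonpos hy.le hy1)) hL.le
  set s := -Real.log x / l with hs
  set t := -Real.log y / l with ht
  have hinv : 1 / ((q : ℝ) - 1) ≤ 2 * (1 / q) := by
    rw [mul_one_div, div_le_div_iff₀ (by linarith) (by linarith)]
    linarith
  have hq0 : 0 < 1 / (q : ℝ) := by positivity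
  have hq1 : 0 < 1 / ((q : ℝ) - 1) := one_div_pos.2 (by linarith)
  have hxy : 0 < x * y := mul_pos hx hy
  have hmain : Real.log (x * y + 1 / (q - 1)) ≤ Real.log 4 + Real.log (max (x * y) (1 / q)) := by
    rw [← Real.log_mul (by norm_num) (lt_max_of_lt_left hxy).ne']
    apply Real.log_le_log (by positivity)
    have := le_max_left (x * y) (1 / (q : ℝ))
    have := le_max_right (x * y) (1 / (q : ℝ))
    linarith
  have hlogxy : Real.log (x * y) = -(l * (s + t)) := by
    rw [Real.log_mul hx.ne' hy.ne', hs, ht]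
    field_simp
    ring
  have hlogq : Real.log (1 / q) = -l := by rw [one_div, Real.log_inv]
  have hmax : Real.log (max (x * y) (1 / q)) ≤
      -(l * (1 - (1 - min 1 s) * (1 - min 1 t))) := by
    have hb0 : 0 ≤ 1 - min 1 s := by linarith [min_le_left 1 s]
    have hb1 : 0 ≤ 1 - min 1 t := by linarith [min_le_left 1 t]
    have hm0 : 0 ≤ min 1 s := le_min zero_le_one hs0
    have hm1 : 0 ≤ min 1 t := le_min zero_le_one ht0
    have hms := min_le_right 1 s
    have hmt := min_le_right 1 t
    rcases max_choice (x * y) (1 / (q : ℝ)) with h | h <;> rw [h]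
    · rw [hlogxy, neg_le_neg_iff]
      exact mul_le_mul_of_nonneg_left (by nlinarith) hL.le
    · rw [hlogq, neg_le_neg_iff]
      nlinarith [mul_nonneg hL.le (mul_nonneg hb0 hb1)]
  linarith

variable {R : Type*} [CommRing R] {α : Type*}

/-- The residue of a random variable modulo `π ^ j`. -/
def residueAt (π : R) (j : ℕ) (X : α → R) (a : α) : R ⧸ Ideal.span {π ^ j} :=
  Ideal.Quotient.mk _ (X a)

theorem residueAt_eq_iff {π : R} {j : ℕ} {X : α → R} {a a' : α} :
    residueAt π j X a = residueAt π j X a' ↔ π ^ j ∣ X a - X a' := by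
  unfold residueAt
  rw [Ideal.Quotient.eq, Ideal.mem_span_singleton]

theorem residueAt_of_succ {π : R} {j : ℕ} {X : α → R} {a a' : α}
    (h : residueAt π (j + 1) X a = residueAt π (j + 1) X a') :
    residueAt π j X a = residueAt π j X a' := by
  rw [residueAt_eq_iff] at *
  exact (pow_dvd_pow π (Nat.le_succ j)).trans h

variable [Fintype α]

/-- The information, in units of `log q` and truncated at `1`, carried at a point by the `j`-th
digit relative to the previous digits. -/
noncomputable def digitInfo (π : R) (q j : ℕ) (X : α → R) (a : α) : ℝ :=
  min 1 (Real.log (fiberCard (residueAt π j X) a / fiberCard (residueAt π (j + 1) X) a) /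
    Real.log q)

/-- The average information carried by the `j`-th digit. -/
noncomputable def digitEntropy (π : R) (q j : ℕ) (X : α → R) : ℝ :=
  (∑ a, digitInfo π q j X a) / Fintype.card α

theorem fiberCard_residueAt_succ_le (π : R) (j : ℕ) (X : α → R) (a : α) :
    (fiberCard (residueAt π (j + 1) X) a : ℝ) ≤ fiberCard (residueAt π j X) a := by
  exact_mod_cast fiberCard_mono (fun _ _ => residueAt_of_succ) a

theorem digitInfo_nonneg (π : R) {q : ℕ} (j : ℕ) (X : α → R) (a : α) :
    0 ≤ digitInfo π q j X a := by
  refine le_min zero_le_one (div_nonneg (Real.log_nonneg ?_) (Real.log_natCast_nonneg q))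
  rw [one_le_div (fiberCard_pos' _ _)]
  exact fiberCard_residueAt_succ_le π j X a

theorem digitEntropy_nonneg (π : R) (q j : ℕ) (X : α → R) : 0 ≤ digitEntropy π q j X :=
  div_nonneg (sum_nonneg fun a _ => digitInfo_nonneg π j X a) (Nat.cast_nonneg _)

theorem digitEntropy_le_one (π : R) (q j : ℕ) (X : α → R) : digitEntropy π q j X ≤ 1 := by
  refine div_le_one_of_le₀ ?_ (Nat.cast_nonneg _)
  refine (sum_le_sum fun a _ => min_le_left _ _).trans ?_
  simp

/-- Only the two partitions into residue classes matter; this identifies digits of X with shifted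
digits of a multiple of X. -/
theorem digitEntropy_congr {π : R} {q j j' : ℕ} {X X' : α → R}
    (h : ∀ a a', π ^ j ∣ X a - X a' ↔ π ^ j' ∣ X' a - X' a')
    (h' : ∀ a a', π ^ (j + 1) ∣ X a - X a' ↔ π ^ (j' + 1) ∣ X' a - X' a') :
    digitEntropy π q j X = digitEntropy π q j' X' := by
  unfold digitEntropy digitInfo
  congr 1
  refine sum_congr rfl fun a _ => ?_
  rw [fiberCard_congr (g := residueAt π j' X') (fun a a' => by
      rw [residueAt_eq_iff, residueAt_eq_iff, h]),
    fiberCard_congr (f := residueAt π (j + 1) X) (g := residueAt π (j' + 1) X') (fun a a' => by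
      rw [residueAt_eq_iff, residueAt_eq_iff, h'])]

theorem digitEntropy_eq_zero {π : R} {q j : ℕ} {X : α → R}
    (h : ∀ a a', π ^ j ∣ X a - X a' → π ^ (j + 1) ∣ X a - X a') : digitEntropy π q j X = 0 := by
  unfold digitEntropy digitInfo
  rw [sum_eq_zero, zero_div]
  intro a _
  rw [fiberCard_congr (f := residueAt π (j + 1) X) (g := residueAt π j X),
    div_self (fiberCard_pos' _ _).ne']
  · simp
  · intro a a'
    refine ⟨residueAt_of_succ, fun h' => ?_⟩
    rw [residueAt_eq_iff] at *
    exact h a a' h'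

theorem fiberCard_residueAt_zero (π : R) (X : α → R) (a : α) :
    fiberCard (residueAt π 0 X) a = Fintype.card α := by
  have : Subsingleton (R ⧸ Ideal.span {π ^ 0}) := by
    rw [pow_zero, Ideal.span_singleton_one]
    infer_instance
  exact fiberCard_of_subsingleton _ _

theorem sum_log_fiberCard_telescope (π : R) (X : α → R) (a : α) (i : ℕ) :
    ∑ j ∈ range i, Real.log (fiberCard (residueAt π j X) a / fiberCard (residueAt π (j + 1) X) a) =
      Real.log (Fintype.card α) - Real.log (fiberCard (residueAt π i X) a) := by
  rw [← fiberCard_residueAt_zero π X a,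
    ← sum_range_sub' (fun j => Real.log (fiberCard (residueAt π j X) a))]
  exact sum_congr rfl fun j _ => Real.log_div (fiberCard_pos' _ _).ne' (fiberCard_pos' _ _).ne'

theorem sum_digitEntropy_le [Nonempty α] (π : R) {q : ℕ} (hq : 2 ≤ q) (X : α → R) (i : ℕ) :
    ∑ j ∈ range i, digitEntropy π q j X ≤ Real.log (Fintype.card α) / Real.log q := by
  have hL : 0 < Real.log q := Real.log_pos (by exact_mod_cast hq)
  have hn : (0 : ℝ) < Fintype.card α := by exact_mod_cast Fintype.card_pos
  unfold digitEntropy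
  rw [← sum_div, sum_comm, div_le_iff₀ hn]
  have h1 : ∀ a ∈ (univ : Finset α), ∑ j ∈ range i, digitInfo π q j X a ≤
      Real.log (Fintype.card α) / Real.log q := by
    intro a _
    refine (sum_le_sum fun j _ => min_le_right _ _).trans ?_
    rw [← sum_div, sum_log_fiberCard_telescope]
    apply div_le_div_of_nonneg_right _ hL.le
    have : 0 ≤ Real.log (fiberCard (residueAt π i X) a) := Real.log_natCast_nonneg _
    linarith
  refine (sum_le_sum h1).trans_eq ?_
  rw [sum_const, card_univ, nsmul_eq_mul, mul_comm]

/-- After exchanging sums, each x contributes the inverse subclass sizes summed over its class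
modulo π^j; this counts occupied subclasses, at most one per digit. -/
theorem sum_fiberCard_ratio_le {π : R} {q : ℕ} (X : α → R) (j : ℕ) {χ : R → Fin q}
    (hχ : ∀ x y : R, π ^ j ∣ x → π ^ j ∣ y → χ x = χ y → π ^ (j + 1) ∣ x - y) :
    ∑ a, (fiberCard (residueAt π j X) a / fiberCard (residueAt π (j + 1) X) a : ℝ) ≤
      q * Fintype.card α := by
  classical
  have h1 : ∀ a, (fiberCard (residueAt π j X) a / fiberCard (residueAt π (j + 1) X) a : ℝ) =
      ∑ x, if residueAt π j X a = residueAt π j X x then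
        (1 : ℝ) / fiberCard (residueAt π (j + 1) X) a else 0 := by
    intro a
    rw [fiberCard_eq_sum (residueAt π j X), sum_div]
    exact sum_congr rfl fun x _ => by split_ifs <;> simp
  rw [sum_congr rfl fun a _ => h1 a, sum_comm]
  have h2 : ∀ x ∈ (univ : Finset α), (∑ a, if residueAt π j X a = residueAt π j X x then
      (1 : ℝ) / fiberCard (residueAt π (j + 1) X) a else 0) ≤ q := by
    intro x _
    rw [← sum_filter]
    set s : Finset α := {a | residueAt π j X a = residueAt π j X x} with hs
    have hmem : ∀ {a}, a ∈ s → π ^ j ∣ X a - X x := fun {a} ha => by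
      rw [hs, mem_filter, residueAt_eq_iff] at ha
      exact ha.2
    have h3 : ∀ a ∈ s, (1 : ℝ) / fiberCard (residueAt π (j + 1) X) a ≤
        1 / #{a' ∈ s | χ (X a' - X x) = χ (X a - X x)} := by
      intro a ha
      apply one_div_le_one_div_of_le
      · exact_mod_cast card_pos.2 ⟨a, by simp [ha]⟩
      · unfold fiberCard
        norm_cast
        apply card_le_card
        intro a' ha'
        rw [mem_filter] at ha' ⊢
        refine ⟨mem_univ _, ?_⟩
        rw [residueAt_eq_iff]
        simpa using hχ _ _ (hmem ha'.1) (hmem ha) ha'.2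
    refine (sum_le_sum h3).trans ?_
    rw [sum_inv_card_fiber s (fun a => χ (X a - X x))]
    have := card_le_univ (s.image fun a => χ (X a - X x))
    rw [Fintype.card_fin] at this
    exact_mod_cast this
  refine (sum_le_sum h2).trans_eq ?_
  rw [sum_const, card_univ, nsmul_eq_mul, mul_comm]

/-- Truncation is cheap: where it acts on a fibre ratio u, the excess is log(u/q) ≤ u/q, and u has
mean at most q. -/
theorem le_digitEntropy [Nonempty α] {π : R} {N q : ℕ} (hR : IsTruncatedDVR π N q) (hq : 2 ≤ q)
    (X : α → R) (j : ℕ) :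
    (∑ a, Real.log (fiberCard (residueAt π j X) a / fiberCard (residueAt π (j + 1) X) a) /
      Real.log q) / Fintype.card α - 1 / Real.log q ≤ digitEntropy π q j X := by
  have hL : 0 < Real.log q := Real.log_pos (by exact_mod_cast hq)
  have hn : (0 : ℝ) < Fintype.card α := by exact_mod_cast Fintype.card_pos
  have hq0 : (0 : ℝ) < q := by exact_mod_cast (by omega : 0 < q)
  obtain ⟨χ, hχ⟩ := hR.exists_digit
  have h1 := sum_fiberCard_ratio_le X j (hχ j)
  unfold digitEntropy
  rw [sub_le_iff_le_add, ← sub_le_iff_le_add', ← sub_div, ← sum_sub_distrib, div_le_iff₀ hn]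
  have h2 : ∀ a ∈ (univ : Finset α),
      Real.log (fiberCard (residueAt π j X) a / fiberCard (residueAt π (j + 1) X) a) /
        Real.log q - digitInfo π q j X a ≤
      (fiberCard (residueAt π j X) a / fiberCard (residueAt π (j + 1) X) a) *
        (1 / (q * Real.log q)) := by
    intro a _
    have hu : (0 : ℝ) < fiberCard (residueAt π j X) a / fiberCard (residueAt π (j + 1) X) a :=
      div_pos (fiberCard_pos' _ _) (fiberCard_pos' _ _)
    unfold digitInfo
    set u : ℝ := fiberCard (residueAt π j X) a / fiberCard (residueAt π (j + 1) X) a with hu'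
    rcases min_choice 1 (Real.log u / Real.log q) with h | h <;> rw [h]
    · have h3 : Real.log (u / q) ≤ u / q := (Real.log_le_sub_one_of_pos (by positivity)).trans
        (by linarith)
      rw [Real.log_div hu.ne' hq0.ne'] at h3
      have h4 : Real.log u / Real.log q - 1 = (Real.log u - Real.log q) / Real.log q := by
        field_simp
      rw [h4, div_le_iff₀ hL]
      refine h3.trans_eq ?_
      field_simp
    · rw [sub_self]
      positivity
  refine (sum_le_sum h2).trans ?_
  rw [← sum_mul]
  refine (mul_le_mul_of_nonneg_right h1 (by positivity)).trans_eq ?_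
  field_simp

/-- A random variable which is injective modulo `π ^ i` has its entropy in the first `i` digits. -/
theorem le_sum_digitEntropy [Nonempty α] {π : R} {N q : ℕ} (hR : IsTruncatedDVR π N q) (hq : 2 ≤ q)
    {X : α → R} {i : ℕ} (hX : ∀ a a', π ^ i ∣ X a - X a' → a = a') :
    Real.log (Fintype.card α) / Real.log q - i / Real.log q ≤
      ∑ j ∈ range i, digitEntropy π q j X := by
  have hn : (0 : ℝ) < Fintype.card α := by exact_mod_cast Fintype.card_pos
  refine le_trans (le_of_eq ?_) (sum_le_sum fun j _ => le_digitEntropy hR hq X j)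
  rw [sum_sub_distrib, ← sum_div, sum_comm]
  have h1 : ∀ a ∈ (univ : Finset α), ∑ j ∈ range i,
      Real.log (fiberCard (residueAt π j X) a / fiberCard (residueAt π (j + 1) X) a) /
        Real.log q = Real.log (Fintype.card α) / Real.log q := by
    intro a _
    rw [← sum_div, sum_log_fiberCard_telescope]
    have : fiberCard (residueAt π i X) a = 1 := by
      unfold fiberCard
      rw [card_eq_one]
      refine ⟨a, ?_⟩
      ext a'
      simp only [mem_filter, mem_univ, true_and, mem_singleton, residueAt_eq_iff]
      exact ⟨hX a' a, fun h => by simp [h]⟩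
    simp [this]
  rw [sum_congr rfl h1, sum_const, sum_const, card_univ, card_range, nsmul_eq_mul, nsmul_eq_mul]
  field_simp

end Levels

/-! ### Entropy growth of X + ωY -/

section Expansion

open Finset

variable {R : Type*} [CommRing R] {α β : Type*} [Fintype α] [Fintype β]

theorem fiberCard_prodMap {γ γ' : Type*} (f : α → γ) (g : β → γ') (p : α × β) :
    fiberCard (Prod.map f g) p = fiberCard f p.1 * fiberCard g p.2 := by
  classical
  unfold fiberCard
  rw [← card_product]
  congr 1
  ext x
  simp [Prod.ext_iff]

/-- The random variable `X + ω Y` on the product space. -/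
def addSmulVar (ω : R) (X : α → R) (Y : β → R) (p : α × β) : R := X p.1 + ω * Y p.2

/-- Average over `ω` of the number of pairs in a residue class which collide at the next level. -/
theorem sum_fiberCard_addSmulVar_le {π : R} (j : ℕ) (X : α → R) (Y : β → R) {Ω : Finset R}
    (hΩ : ∀ ω ∈ Ω, ∀ ω' ∈ Ω, ω ≠ ω' → IsUnit (ω - ω')) (p : α × β) :
    ∑ ω ∈ Ω, (fiberCard (fun p => (residueAt π (j + 1) (addSmulVar ω X Y) p,
      Prod.map (residueAt π j X) (residueAt π j Y) p)) p : ℝ) ≤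
    #Ω * (fiberCard (residueAt π (j + 1) X) p.1 * fiberCard (residueAt π (j + 1) Y) p.2) +
      fiberCard (residueAt π j X) p.1 * fiberCard (residueAt π j Y) p.2 := by
  classical
  set k : α × β → _ := Prod.map (residueAt π j X) (residueAt π j Y) with hk
  set F : Finset (α × β) := {p' | k p' = k p} with hF
  have hFcard : #F = fiberCard (residueAt π j X) p.1 * fiberCard (residueAt π j Y) p.2 := by
    rw [← fiberCard_prodMap]
    unfold fiberCard
    rw [hF]
    congr
  set k' : α × β → _ := Prod.map (residueAt π (j + 1) X) (residueAt π (j + 1) Y) with hk'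
  set G : Finset (α × β) := {p' | k' p' = k' p} with hG
  have hGcard : #G =
      fiberCard (residueAt π (j + 1) X) p.1 * fiberCard (residueAt π (j + 1) Y) p.2 := by
    rw [← fiberCard_prodMap]
    unfold fiberCard
    rw [hG]
    congr
  -- whether `p'` collides with `p` for `ω`, with different second coordinates
  set T : R → α × β → Prop := fun ω p' => ¬ π ^ (j + 1) ∣ Y p'.2 - Y p.2 ∧
    π ^ (j + 1) ∣ addSmulVar ω X Y p' - addSmulVar ω X Y p with hT
  have h1 : ∀ ω, fiberCard (fun p => (residueAt π (j + 1) (addSmulVar ω X Y) p, k p)) p ≤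
      #G + #{p' ∈ F | T ω p'} := by
    intro ω
    unfold fiberCard
    refine (card_le_card ?_).trans (card_union_le G {p' ∈ F | T ω p'})
    intro p' hp'
    simp only [mem_filter, mem_univ, true_and, Prod.mk.injEq, residueAt_eq_iff] at hp'
    by_cases hy : π ^ (j + 1) ∣ Y p'.2 - Y p.2
    · apply mem_union_left
      simp only [hG, hk', mem_filter, mem_univ, true_and, Prod.ext_iff, Prod.map_fst,
        Prod.map_snd, residueAt_eq_iff]
      refine ⟨?_, hy⟩
      have h2 := dvd_sub hp'.1 (hy.mul_left ω)
      have h3 : addSmulVar ω X Y p' - addSmulVar ω X Y p - ω * (Y p'.2 - Y p.2) =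
          X p'.1 - X p.1 := by
        unfold addSmulVar; ring
      rwa [h3] at h2
    · apply mem_union_right
      simp only [hF, mem_filter, mem_univ, true_and]
      exact ⟨hp'.2, hy, hp'.1⟩
  -- Subtracting the collisions for ω and ω' leaves (ω − ω')(Y p' − Y p), and ω − ω' is a unit.
  have h2 : ∀ p' ∈ F, #{ω ∈ Ω | T ω p'} ≤ 1 := by
    intro p' _
    rw [card_le_one]
    intro ω hω ω' hω'
    rw [mem_filter] at hω hω'
    by_contra hne
    have h3 := dvd_sub hω.2.2 hω'.2.2
    have h4 : addSmulVar ω X Y p' - addSmulVar ω X Y p -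
        (addSmulVar ω' X Y p' - addSmulVar ω' X Y p) = (ω - ω') * (Y p'.2 - Y p.2) := by
      unfold addSmulVar; ring
    rw [h4] at h3
    exact hω.2.1 ((hΩ ω hω.1 ω' hω'.1 hne).dvd_mul_left.1 h3)
  have h3 : ∑ ω ∈ Ω, #{p' ∈ F | T ω p'} ≤ #F := by
    have : ∑ ω ∈ Ω, #{p' ∈ F | T ω p'} = ∑ p' ∈ F, #{ω ∈ Ω | T ω p'} :=
      sum_card_bipartiteAbove_eq_sum_card_bipartiteBelow T
    rw [this]
    simpa using sum_le_card_nsmul F _ 1 h2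
  have h4 : ∑ ω ∈ Ω, fiberCard (fun p => (residueAt π (j + 1) (addSmulVar ω X Y) p, k p)) p ≤
      #Ω * #G + #F := by
    refine (sum_le_sum fun ω _ => h1 ω).trans ?_
    rw [sum_add_distrib, sum_const, smul_eq_mul]
    omega
  rw [hFcard, hGcard] at h4
  exact_mod_cast h4

/-- A weak form of Jensen's inequality for the logarithm. -/
theorem neg_log_le_sum_log_sub_log {ι : Type*} {Ω : Finset ι} (hΩ : (0 : ℝ) < #Ω) {m : ι → ℝ}
    (hm : ∀ ω, 0 < m ω) {a b a' b' : ℝ} (ha : 0 < a) (hb : 0 < b) (ha' : 0 < a') (hb' : 0 < b')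
    (h : ∑ ω ∈ Ω, m ω ≤ #Ω * (a' * b') + a * b) :
    #Ω * -Real.log (a' / a * (b' / b) + 1 / #Ω) ≤
      ∑ ω ∈ Ω, (Real.log (a * b) - Real.log (m ω)) := by
  set c : ℝ := a' / a * (b' / b) + 1 / #Ω with hc
  have hc0 : 0 < c := by positivity
  -- The tangent line of log at c replaces concavity, because c bounds the mean of m ω / (ab).
  have h3 : ∀ ω ∈ Ω, 1 - Real.log c - m ω / (a * b * c) ≤ Real.log (a * b) - Real.log (m ω) := by
    intro ω _
    have h4 := Real.log_le_sub_one_of_pos (div_pos (hm ω) (by positivity : 0 < a * b * c))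
    rw [Real.log_div (hm ω).ne' (by positivity), Real.log_mul (by positivity) hc0.ne'] at h4
    linarith
  refine le_trans ?_ (sum_le_sum h3)
  rw [sum_sub_distrib, sum_const, nsmul_eq_mul, ← sum_div]
  have h5 : (∑ ω ∈ Ω, m ω) / (a * b * c) ≤ #Ω := by
    rw [div_le_iff₀ (by positivity)]
    refine h.trans_eq ?_
    have e1 : (#Ω : ℝ) * (a * b * c) = #Ω * (a * b * (a' / a * (b' / b))) +
        a * b * (#Ω * (1 / #Ω)) := by
      rw [hc]; ring
    have e2 : a * b * (a' / a * (b' / b)) = a' * b' := by field_simp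
    rw [e1, e2, mul_one_div_cancel hΩ.ne', mul_one]
  linarith

/-- The information carried by a digit of `X + ω Y` for typical `ω`. -/
theorem le_sum_log_fiberCard_ratio {π : R} {q : ℕ} (hq : 2 ≤ q) (j : ℕ) (X : α → R) (Y : β → R)
    {Ω : Finset R} (hΩ : ∀ ω ∈ Ω, ∀ ω' ∈ Ω, ω ≠ ω' → IsUnit (ω - ω')) (hΩc : #Ω + 1 = q)
    (p : α × β) :
    #Ω * (Real.log q * (1 - (1 - digitInfo π q j X p.1) * (1 - digitInfo π q j Y p.2)) -
      Real.log 4) ≤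
    ∑ ω ∈ Ω, (Real.log (fiberCard (Prod.map (residueAt π j X) (residueAt π j Y)) p) -
      Real.log (fiberCard (fun p => (residueAt π (j + 1) (addSmulVar ω X Y) p,
        Prod.map (residueAt π j X) (residueAt π j Y) p)) p)) := by
  have h1 := sum_fiberCard_addSmulVar_le (π := π) j X Y hΩ p
  have hΩR : (#Ω : ℝ) = q - 1 := by rw [← hΩc]; push_cast; ring
  have hΩ0 : (0 : ℝ) < #Ω := by exact_mod_cast (by omega : 0 < #Ω)
  rw [fiberCard_prodMap]
  rw [Nat.cast_mul]
  set m : R → ℝ := fun ω => (fiberCard (fun p => (residueAt π (j + 1) (addSmulVar ω X Y) p,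
    Prod.map (residueAt π j X) (residueAt π j Y) p)) p : ℝ) with hm
  have hm0 : ∀ ω, 0 < m ω := fun ω => fiberCard_pos' _ _
  have ha := fiberCard_pos' (residueAt π j X) p.1
  have hb := fiberCard_pos' (residueAt π j Y) p.2
  have ha' := fiberCard_pos' (residueAt π (j + 1) X) p.1
  have hb' := fiberCard_pos' (residueAt π (j + 1) Y) p.2
  have hxle := fiberCard_residueAt_succ_le π j X p.1
  have hyle := fiberCard_residueAt_succ_le π j Y p.2
  have h2 := one_sub_mul_one_sub_le_neg_log hq (div_pos ha' ha) ((div_le_one ha).2 hxle)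
    (div_pos hb' hb) ((div_le_one hb).2 hyle)
  have hneg : ∀ u v : ℝ, -Real.log (u / v) = Real.log (v / u) := fun u v => by
    rw [← Real.log_inv, inv_div]
  rw [hneg, hneg] at h2
  unfold digitInfo
  refine (mul_le_mul_of_nonneg_left h2 hΩ0.le).trans ?_
  rw [← hΩR]
  exact neg_log_le_sum_log_sub_log hΩ0 hm0 ha hb ha' hb' h1

/-- A random variable `X + ω Y` carries, for typical `ω`, the information of both `X` and `Y` as far
as there is room for it. -/
theorem le_sum_log_card [Nonempty α] [Nonempty β] {π : R} {N q : ℕ} (hq : 2 ≤ q)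
    (X : α → R) (Y : β → R)
    {Ω : Finset R} (hΩ : ∀ ω ∈ Ω, ∀ ω' ∈ Ω, ω ≠ ω' → IsUnit (ω - ω')) (hΩc : #Ω + 1 = q)
    {S : R → Finset R} (hS : ∀ ω ∈ Ω, ∀ a b, X a + ω * Y b ∈ S ω) :
    #Ω * (Real.log q * ∑ j ∈ range N, (1 - (1 - digitEntropy π q j X) *
      (1 - digitEntropy π q j Y)) - N * Real.log 4) ≤ ∑ ω ∈ Ω, Real.log #(S ω) := by
  classical
  set n : ℝ := (Fintype.card (α × β) : ℝ) with hn
  have hαpos : (0 : ℝ) < Fintype.card α := by exact_mod_cast Fintype.card_pos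
  have hβpos : (0 : ℝ) < Fintype.card β := by exact_mod_cast Fintype.card_pos
  have hnn : n = Fintype.card α * Fintype.card β := by
    rw [hn, Fintype.card_prod]; push_cast; rfl
  have hn0 : 0 < n := by rw [hnn]; positivity
  set Z : R → α × β → R := fun ω => addSmulVar ω X Y with hZ
  set k : (j : ℕ) → α × β → _ := fun j => Prod.map (residueAt π j X) (residueAt π j Y) with hk
  -- the entropy of `Z ω` as a sum over digits
  have h1 : ∀ ω ∈ Ω, ∑ j ∈ range N, ∑ p, (Real.log (fiberCard (k j) p) -
      Real.log (fiberCard (fun p => (residueAt π (j + 1) (Z ω) p, k j p)) p)) ≤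
      n * Real.log #(S ω) := by
    intro ω hω
    have hsup : n * Real.log n - ∑ p, Real.log (fiberCard (residueAt π N (Z ω)) p) ≤
        n * Real.log #(S ω) := by
      have h2 := log_card_le_sum_log_fiberCard (residueAt π N (Z ω))
        ((S ω).image (Ideal.Quotient.mk _)) (fun p => mem_image_of_mem _ (hS ω hω p.1 p.2))
      refine h2.trans (mul_le_mul_of_nonneg_left ?_ hn0.le)
      apply Real.log_le_log
      · obtain ⟨a⟩ := ‹Nonempty α›
        obtain ⟨b⟩ := ‹Nonempty β›
        exact_mod_cast card_pos.2 ⟨_, mem_image_of_mem _ (hS ω hω a b)⟩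
      · exact_mod_cast card_image_le
    refine le_trans ?_ hsup
    have h3 : ∑ p, Real.log (fiberCard (residueAt π 0 (Z ω)) p) = n * Real.log n := by
      rw [sum_congr rfl fun p _ => by rw [fiberCard_residueAt_zero], sum_const, card_univ,
        nsmul_eq_mul]
    rw [← h3, ← sum_range_sub' (fun j => ∑ p, Real.log (fiberCard (residueAt π j (Z ω)) p))]
    refine sum_le_sum fun j _ => ?_
    -- Conditioning on X and Y modulo π^j, which determine X + ωY modulo π^j, can only lower the
    -- entropy of its next digit.
    have h4 := sum_log_fiberCard_submodular (residueAt π (j + 1) (Z ω)) (k j)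
      (residueAt π j (Z ω))
      (Ideal.Quotient.factor (S := Ideal.span {π ^ (j + 1)}) (T := Ideal.span {π ^ j})
        (Ideal.span_singleton_le_span_singleton.2 (pow_dvd_pow π (Nat.le_succ j))))
      (fun x => x.1 + Ideal.Quotient.mk _ ω * x.2) (fun p => rfl) (fun p => by
        simp only [hk, hZ, residueAt, addSmulVar, Prod.map_fst, Prod.map_snd, map_add, map_mul])
    rw [sum_sub_distrib]
    linarith
  have h2 := sum_le_sum h1
  rw [← mul_sum, sum_comm] at h2
  have h3 : ∀ j ∈ range N, n * (#Ω * (Real.log q * (1 - (1 - digitEntropy π q j X) *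
      (1 - digitEntropy π q j Y)) - Real.log 4)) ≤
      ∑ ω ∈ Ω, ∑ p, (Real.log (fiberCard (k j) p) -
      Real.log (fiberCard (fun p => (residueAt π (j + 1) (Z ω) p, k j p)) p)) := by
    intro j _
    rw [sum_comm]
    refine le_trans (le_of_eq ?_)
      (sum_le_sum fun p _ => le_sum_log_fiberCard_ratio hq j X Y hΩ hΩc p)
    -- Independence of X and Y turns the mean of the product into the product of the means.
    have h4 : ∑ p : α × β, (1 - digitInfo π q j X p.1) * (1 - digitInfo π q j Y p.2) =
        n * ((1 - digitEntropy π q j X) * (1 - digitEntropy π q j Y)) := by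
      rw [Fintype.sum_prod_type]
      change ∑ x : α, ∑ y : β, (1 - digitInfo π q j X x) * (1 - digitInfo π q j Y y) = _
      rw [← Fintype.sum_mul_sum, sum_sub_distrib, sum_sub_distrib]
      unfold digitEntropy
      simp only [sum_const, card_univ, nsmul_eq_mul, mul_one]
      rw [hnn]
      field_simp
    rw [← mul_sum, sum_sub_distrib, ← mul_sum, sum_sub_distrib, h4]
    simp only [sum_const, card_univ, nsmul_eq_mul, mul_one]
    ring
  have h5 := (sum_le_sum h3).trans h2
  rw [← mul_sum, ← mul_sum, sum_sub_distrib, ← mul_sum, sum_const, card_range, nsmul_eq_mul] at h5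
  exact le_of_mul_le_mul_left h5 hn0

end Expansion

/-! ### Elements of ⟨A⟩_6 -/

section Gen

variable {R : Type*} [CommRing R] {A : Set R}

/-- Powers of c pad each product to six factors, and five equal summands, cancelling in the
difference, pad each sum to six terms. -/
theorem pow_mul_sub_mem_gen {c x y : R} (hc : c ∈ A) (hx : x ∈ A) (hy : y ∈ A) :
    c ^ 5 * (x - y) ∈ gen A 6 := by
  have hp : ∀ z ∈ A, c ^ 5 * z ∈ prodSet 6 A := fun z hz =>
    ⟨![z, c, c, c, c, c], fun i => by fin_cases i <;> simp [hc, hz], by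
      simp [Fin.prod_univ_succ]; ring⟩
  rw [mul_sub]
  have e : c ^ 5 * x - c ^ 5 * y = (c ^ 5 * x + 5 * (c ^ 5 * x)) -
      (c ^ 5 * y + 5 * (c ^ 5 * x)) := by ring
  rw [e]
  refine Set.sub_mem_sub ?_ ?_
  · refine ⟨fun _ => c ^ 5 * x, fun _ => hp x hx, ?_⟩
    simp; ring
  · refine ⟨![c ^ 5 * y, c ^ 5 * x, c ^ 5 * x, c ^ 5 * x, c ^ 5 * x, c ^ 5 * x],
      fun i => by fin_cases i <;> simp [hp x hx, hp y hy], ?_⟩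
    simp [Fin.sum_univ_succ]; ring

theorem pow_mul_sub_mul_sub_mem_gen {c a b x y : R} (hc : c ∈ A) (ha : a ∈ A) (hb : b ∈ A)
    (hx : x ∈ A) (hy : y ∈ A) : c ^ 4 * ((a - b) * (x - y)) ∈ gen A 6 := by
  have hp : ∀ w ∈ A, ∀ z ∈ A, c ^ 4 * (w * z) ∈ prodSet 6 A := fun w hw z hz =>
    ⟨![w, z, c, c, c, c], fun i => by fin_cases i <;> simp [hc, hw, hz], by
      simp [Fin.prod_univ_succ]; ring⟩
  have e : c ^ 4 * ((a - b) * (x - y)) =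
      (c ^ 4 * (a * x) + c ^ 4 * (b * y) + 4 * (c ^ 4 * (a * x))) -
      (c ^ 4 * (a * y) + c ^ 4 * (b * x) + 4 * (c ^ 4 * (a * x))) := by ring
  rw [e]
  refine Set.sub_mem_sub ?_ ?_
  · refine ⟨![c ^ 4 * (a * x), c ^ 4 * (b * y), c ^ 4 * (a * x), c ^ 4 * (a * x),
      c ^ 4 * (a * x), c ^ 4 * (a * x)],
      fun i => by fin_cases i <;> simp [hp a ha x hx, hp b hb y hy], ?_⟩
    simp [Fin.sum_univ_succ]; ring
  · refine ⟨![c ^ 4 * (a * y), c ^ 4 * (b * x), c ^ 4 * (a * x), c ^ 4 * (a * x),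
      c ^ 4 * (a * x), c ^ 4 * (a * x)],
      fun i => by fin_cases i <;> simp [hp a ha y hy, hp a ha x hx, hp b hb x hx], ?_⟩
    simp [Fin.sum_univ_succ]; ring

end Gen

/-! ### From non-expansion to a contradiction -/

section Expansion

open Finset

variable {R : Type*} [CommRing R] {α β : Type*} [Fintype α] [Fintype β]

/-- If no `X + ω Y` has many more values than `X`, then the digits of `Y` carry information only
where those of `X` are already saturated. -/
theorem sum_digitEntropy_mul_le [Nonempty α] [Nonempty β] {π : R} {N q : ℕ}
    (hR : IsTruncatedDVR π N q) (hq : 2 ≤ q) {δ : ℝ} (hδ : 3 ≤ δ * Real.log q)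
    {X : α → R} (hX : Function.Injective X) (Y : β → R)
    {Ω : Finset R} (hΩ : ∀ ω ∈ Ω, ∀ ω' ∈ Ω, ω ≠ ω' → IsUnit (ω - ω')) (hΩc : #Ω + 1 = q)
    {S : R → Finset R} (hS : ∀ ω ∈ Ω, ∀ a b, X a + ω * Y b ∈ S ω)
    (hcard : ∀ ω ∈ Ω, Real.log #(S ω) ≤ Real.log (Fintype.card α) + N * δ * Real.log q) :
    ∑ j ∈ range N, digitEntropy π q j Y * (1 - digitEntropy π q j X) ≤ 2 * δ * N := by
  have hL : 0 < Real.log q := Real.log_pos (by exact_mod_cast hq)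
  have hΩ0 : (0 : ℝ) < #Ω := by exact_mod_cast (by omega : 0 < #Ω)
  have h1 := (le_sum_log_card (π := π) (N := N) hq X Y hΩ hΩc hS).trans (sum_le_sum hcard)
  rw [sum_const, nsmul_eq_mul] at h1
  have h2 := le_of_mul_le_mul_left h1 hΩ0
  have h3 := le_sum_digitEntropy hR hq (X := X) (i := N) fun a a' h => by
    rw [hR.pow_eq_zero, zero_dvd_iff, sub_eq_zero] at h
    exact hX h
  have h4 : ∑ j ∈ range N, (1 - (1 - digitEntropy π q j X) * (1 - digitEntropy π q j Y)) =
      ∑ j ∈ range N, digitEntropy π q j X +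
        ∑ j ∈ range N, digitEntropy π q j Y * (1 - digitEntropy π q j X) := by
    rw [← sum_add_distrib]
    exact sum_congr rfl fun j _ => by ring
  rw [h4, mul_add] at h2
  rw [← sub_div, div_le_iff₀' hL] at h3
  -- The 3 in `hδ` is 1 for the truncation loss plus 2 for log 4; together they cost at most one
  -- further δN.
  have h5 : Real.log 4 ≤ 2 := by
    have : (4 : ℝ) = 2 ^ 2 := by norm_num
    rw [this, Real.log_pow]
    push_cast
    linarith [Real.log_two_lt_d9]
  have hN : (0 : ℝ) ≤ N := Nat.cast_nonneg N
  have h6 := mul_le_mul_of_nonneg_left h5 hN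
  have h7 := mul_le_mul_of_nonneg_left hδ hN
  refine le_of_mul_le_mul_left (a := Real.log q) ?_ hL
  linarith

/-- The expansion statement in a truncated discrete valuation ring, for the critical `δ`. -/
theorem IsTruncatedDVR.exists_log_card_lt {π : R} {N q : ℕ} (hR : IsTruncatedDVR π N q)
    (hN : 0 < N) (hq : 2 ≤ q) {ε δ : ℝ} (hε : 0 < ε) (hε1 : ε ≤ 1) (hδ : δ = ε ^ 5 / 2000)
    (hqδ : 3 ≤ δ * Real.log q)
    {Ω : Finset R} (hΩ : ∀ ω ∈ Ω, ∀ ω' ∈ Ω, ω ≠ ω' → IsUnit (ω - ω')) (hΩc : #Ω + 1 = q)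
    {A : Finset R} (hA : Real.log #A ≤ N * (1 - ε) * Real.log q)
    (hproj : ∀ i : ℕ, N * δ ≤ i → i ≤ N → ∃ B ⊆ A, B.Nonempty ∧
      (∀ b ∈ B, ∀ b' ∈ B, π ^ i ∣ b - b' → b = b') ∧ i * ε * Real.log q ≤ Real.log #B)
    (h0 : ∃ a ∈ A, ∃ b ∈ A, ¬ π ∣ a - b)
    (h1 : 1 < N → ∃ a ∈ A, ∃ b ∈ A, π ∣ a - b ∧ ¬ π ^ 2 ∣ a - b)
    {S : R → Finset R} (hS : ∀ ω ∈ Ω, ∀ x ∈ gen (A : Set R) 6, ∀ y ∈ gen (A : Set R) 6,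
      x + ω * y ∈ S ω) :
    ∃ ω ∈ Ω, Real.log #A + N * δ * Real.log q < Real.log #(S ω) := by
  classical
  by_contra! hcon
  have hL : 0 < Real.log q := Real.log_pos (by exact_mod_cast hq)
  have hδ0 : 0 < δ := by rw [hδ]; positivity
  have hδε : δ ≤ ε := by
    have : ε ^ 5 ≤ ε := by simpa using pow_le_pow_of_le_one hε.le hε1 (show 1 ≤ 5 by norm_num)
    rw [hδ]; linarith
  -- a unit in `A`
  obtain ⟨c, hcA, hc⟩ : ∃ c ∈ A, IsUnit c := by
    obtain ⟨a, ha, b, hb, hab⟩ := h0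
    by_cases h : π ∣ a
    · exact ⟨b, hb, hR.isUnit_of_not_dvd b fun h' => hab (dvd_sub h h')⟩
    · exact ⟨a, ha, hR.isUnit_of_not_dvd a h⟩
  have : Nonempty A := ⟨⟨c, hcA⟩⟩
  set X : A → R := fun a => c ^ 5 * ((a : R) - c) with hX
  have hXsub : ∀ a a' : A, X a - X a' = c ^ 5 * ((a : R) - a') := fun a a' => by
    simp only [hX]; ring
  have hXdvd : ∀ (j : ℕ) (a a' : A), π ^ j ∣ X a - X a' ↔ π ^ j ∣ (a : R) - a' := fun j a a' => by
    rw [hXsub, (hc.pow 5).dvd_mul_left]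
  have hXinj : Function.Injective X := fun a a' h => by
    have h2 := (hXdvd N a a').1 (by rw [h, sub_self]; exact dvd_zero _)
    rw [hR.pow_eq_zero, zero_dvd_iff, sub_eq_zero] at h2
    exact Subtype.ext h2
  have hXgen : ∀ a, X a ∈ gen (A : Set R) 6 := fun a => pow_mul_sub_mem_gen hcA a.2 hcA
  have key : ∀ {β : Type _} [Fintype β] [Nonempty β] (Y : β → R),
      (∀ b, Y b ∈ gen (A : Set R) 6) →
      ∑ j ∈ range N, digitEntropy π q j Y * (1 - digitEntropy π q j X) ≤ 2 * δ * N := by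
    intro β _ _ Y hY
    refine sum_digitEntropy_mul_le hR hq hqδ hXinj Y hΩ hΩc
      (fun ω hω a b => hS ω hω _ (hXgen a) _ (hY b)) fun ω hω => ?_
    rw [Fintype.card_coe]
    exact hcon ω hω
  set f : ℕ → ℝ := fun j => if j < N then digitEntropy π q j X else 1 with hf
  have hf_lt : ∀ {j}, j < N → f j = digitEntropy π q j X := fun h => if_pos h
  have hf_ge : ∀ j, N ≤ j → f j = 1 := fun j h => if_neg (by omega)
  have hf0 : ∀ j, 0 ≤ f j := fun j => by
    simp only [hf]; split_ifs
    · exact digitEntropy_nonneg _ _ _ _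
    · exact zero_le_one
  have hf1 : ∀ j, f j ≤ 1 := fun j => by
    simp only [hf]; split_ifs
    · exact digitEntropy_le_one _ _ _ _
    · exact le_rfl
  set V : Finset ℕ := {v ∈ range N | ∃ a ∈ A, ∃ b ∈ A, π ^ v ∣ a - b ∧ ¬ π ^ (v + 1) ∣ a - b}
    with hV
  have hVdef : ∀ v ∈ V, shiftDefect f N v ≤ 2 * δ * N := by
    intro v hv
    rw [hV, mem_filter, mem_range] at hv
    obtain ⟨hvN, a, ha, b, hb, hd1, hd2⟩ := hv
    set Y : A → R := fun x => c ^ 4 * ((a - b) * ((x : R) - c)) with hY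
    have hYsub : ∀ x x' : A, Y x - Y x' = c ^ 4 * ((a - b) * ((x : R) - x')) := fun x x' => by
      simp only [hY]; ring
    have hYdvd : ∀ j, v + j ≤ N → ∀ x x' : A, π ^ j ∣ X x - X x' ↔ π ^ (v + j) ∣ Y x - Y x' :=
      fun j hj x x' => by
        rw [hYsub, (hc.pow 4).dvd_mul_left, hR.mul_dvd_iff hj hd1 hd2, hXdvd]
    have hent : ∀ j, v + j < N → digitEntropy π q j X = digitEntropy π q (v + j) Y := fun j hj =>
      digitEntropy_congr (hYdvd j hj.le) (hYdvd (j + 1) hj)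
    have h2 := key Y fun x => pow_mul_sub_mul_sub_mem_gen hcA ha hb x.2 hcA
    refine le_trans ?_ h2
    -- Digit v + j of Y has the information of digit j of X. Shifts landing at or beyond N vanish,
    -- since f = 1 there.
    have e1 : shiftDefect f N v = ∑ j ∈ range (N - v),
        digitEntropy π q (v + j) Y * (1 - digitEntropy π q (v + j) X) := by
      unfold shiftDefect
      obtain ⟨M, rfl⟩ : ∃ M, N = M + v := ⟨N - v, by omega⟩
      rw [sum_range_add, Nat.add_sub_cancel]
      have hz : ∑ x ∈ range v, f (M + x) * (1 - f (M + x + v)) = 0 :=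
        sum_eq_zero fun x _ => by rw [hf_ge (M + x + v) (by omega)]; ring
      rw [hz, add_zero]
      refine sum_congr rfl fun j hj => ?_
      rw [mem_range] at hj
      rw [hf_lt (by omega), hf_lt (by omega), hent j (by omega), add_comm j v]
    have e2 : ∑ j ∈ range N, digitEntropy π q j Y * (1 - digitEntropy π q j X) =
        ∑ j ∈ range v, digitEntropy π q j Y * (1 - digitEntropy π q j X) +
        ∑ j ∈ range (N - v), digitEntropy π q (v + j) Y * (1 - digitEntropy π q (v + j) X) := by
      rw [← sum_range_add]
      congr 2
      omega
    rw [e1, e2]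
    refine le_add_of_nonneg_left (sum_nonneg fun j _ => ?_)
    exact mul_nonneg (digitEntropy_nonneg _ _ _ _) (sub_nonneg.2 (digitEntropy_le_one _ _ _ _))
  have hprojs : ∀ i : ℕ, N * δ ≤ i → i ≤ N → ε / 2 * i ≤ #{v ∈ V | v < i} ∧
      ε / 2 * i - 2 * δ * N ≤ ∑ j ∈ range i, f j := by
    intro i hi hiN
    obtain ⟨B, hBA, ⟨b₀, hb₀⟩, hBinj, hBcard⟩ := hproj i hi hiN
    have : Nonempty B := ⟨⟨b₀, hb₀⟩⟩
    set Y : B → R := fun b => c ^ 5 * ((b : R) - c) with hY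
    have hYsub : ∀ b b' : B, Y b - Y b' = c ^ 5 * ((b : R) - b') := fun b b' => by
      simp only [hY]; ring
    have hYdvd : ∀ (j : ℕ) (b b' : B), π ^ j ∣ Y b - Y b' ↔ π ^ j ∣ (b : R) - b' :=
      fun j b b' => by rw [hYsub, (hc.pow 5).dvd_mul_left]
    have h2 := le_sum_digitEntropy hR hq (X := Y) (i := i) fun b b' h =>
      Subtype.ext (hBinj b b.2 b' b'.2 ((hYdvd i b b').1 h))
    have hlow : ε / 2 * i ≤ ∑ j ∈ range i, digitEntropy π q j Y := by
      refine le_trans ?_ h2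
      rw [Fintype.card_coe, ← sub_div, le_div_iff₀ hL]
      have hi0 : (0 : ℝ) ≤ i := Nat.cast_nonneg i
      have h3 : 1 ≤ ε / 2 * Real.log q := by
        have := mul_le_mul_of_nonneg_right hδε hL.le
        linarith
      have h4 := mul_le_mul_of_nonneg_left h3 hi0
      linarith
    have h3 := key Y fun b => pow_mul_sub_mem_gen hcA (hBA b.2) hcA
    refine ⟨hlow.trans ?_, ?_⟩
    · have h4 : ∀ j ∈ range i, digitEntropy π q j Y ≤ if j ∈ V then 1 else 0 := by
        intro j hj
        rw [mem_range] at hj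
        split_ifs with hjV
        · exact digitEntropy_le_one _ _ _ _
        · refine (digitEntropy_eq_zero fun b b' hbb => ?_).le
          by_contra hnd
          rw [hYdvd] at hbb hnd
          exact hjV (mem_filter.2 ⟨mem_range.2 (by omega), b, hBA b.2, b', hBA b'.2, hbb, hnd⟩)
      refine (sum_le_sum h4).trans_eq ?_
      rw [sum_boole]
      congr 2
      ext v
      simp only [mem_filter, mem_range]
      exact and_comm
    · have h4 : ∑ j ∈ range i, digitEntropy π q j Y * (1 - digitEntropy π q j X) ≤ 2 * δ * N := by
        refine le_trans (sum_le_sum_of_subset_of_nonneg (range_mono hiN) fun j _ _ => ?_) h3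
        exact mul_nonneg (digitEntropy_nonneg _ _ _ _)
          (sub_nonneg.2 (digitEntropy_le_one _ _ _ _))
      have h5 : ∀ j ∈ range i, digitEntropy π q j Y -
          digitEntropy π q j Y * (1 - digitEntropy π q j X) ≤ f j := by
        intro j hj
        rw [mem_range] at hj
        rw [hf_lt (by omega)]
        have h6 := digitEntropy_le_one π q j Y
        have h7 := digitEntropy_nonneg π q j X
        nlinarith
      have h8 := sum_le_sum h5
      rw [sum_sub_distrib] at h8
      linarith
  refine false_of_shiftDefect_small hN hf0 hf1 hf_ge hε hε1 hδ
    (fun i hi hiN => (hprojs i hi hiN).1) hVdef ?_ ?_ ?_ (fun i hi hiN => (hprojs i hi hiN).2)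
  · obtain ⟨a, ha, b, hb, hab⟩ := h0
    exact mem_filter.2 ⟨mem_range.2 hN, a, ha, b, hb, by simp, by simpa using hab⟩
  · intro hN1
    obtain ⟨a, ha, b, hb, hab, hab'⟩ := h1 hN1
    exact mem_filter.2 ⟨mem_range.2 hN1, a, ha, b, hb, by simpa using hab, hab'⟩
  · have h2 := sum_digitEntropy_le π hq X N
    rw [Fintype.card_coe, le_div_iff₀ hL] at h2
    have h3 : ∑ j ∈ range N, f j = ∑ j ∈ range N, digitEntropy π q j X :=
      sum_congr rfl fun j hj => hf_lt (mem_range.1 hj)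
    rw [h3]
    exact le_of_mul_le_mul_right (h2.trans hA) hL

end Expansion

/-! ### Transfer to the original statement -/

open Finset in
/-- Representatives of the units of the residue field, pushed to `O ⧸ P ^ N`. -/
theorem exists_finset_representatives {O : Type*} [CommRing O] {P : Ideal O} [P.IsMaximal]
    [Finite (O ⧸ P)] {N : ℕ} (hN : 0 < N) {Ω : Set O}
    (hΩ : Set.BijOn (Ideal.Quotient.mk P) Ω {x | IsUnit x}) :
    ∃ Ω' : Finset (O ⧸ P ^ N), (∀ w ∈ Ω', ∃ ω ∈ Ω, w = Ideal.Quotient.mk (P ^ N) ω) ∧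
      (∀ w ∈ Ω', ∀ w' ∈ Ω', w ≠ w' → IsUnit (w - w')) ∧ #Ω' + 1 = Nat.card (O ⧸ P) := by
  classical
  let := Ideal.Quotient.field P
  have hfin : Ω.Finite := Set.Finite.of_finite_image (Set.toFinite _) hΩ.injOn
  have hdiff : ∀ ω ∈ Ω, ∀ ω' ∈ Ω, ω ≠ ω' → ω - ω' ∉ P := fun ω hω ω' hω' hne hmem =>
    hne (hΩ.injOn hω hω' ((Ideal.Quotient.eq).2 hmem))
  refine ⟨hfin.toFinset.image (Ideal.Quotient.mk (P ^ N)), ?_, ?_, ?_⟩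
  · intro w hw
    obtain ⟨ω, hω, rfl⟩ := mem_image.1 hw
    exact ⟨ω, hfin.mem_toFinset.1 hω, rfl⟩
  · intro w hw w' hw' hne
    obtain ⟨ω, hω, rfl⟩ := mem_image.1 hw
    obtain ⟨ω', hω', rfl⟩ := mem_image.1 hw'
    rw [← map_sub]
    refine Ideal.Quotient.isUnit_mk_pow_of_notMem _
      (hdiff ω (hfin.mem_toFinset.1 hω) ω' (hfin.mem_toFinset.1 hω') ?_)
    rintro rfl
    exact hne rfl
  · rw [card_image_of_injOn]
    · have h1 : Ω.ncard = ({x | IsUnit x} : Set (O ⧸ P)).ncard := by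
        rw [← hΩ.image_eq, hΩ.injOn.ncard_image]
      have h2 : ({x | IsUnit x} : Set (O ⧸ P)) = {0}ᶜ := by
        ext x
        simp [isUnit_iff_ne_zero]
      have h3 := Set.ncard_add_ncard_compl ({0} : Set (O ⧸ P))
      rw [← h2, ← h1, Set.ncard_singleton] at h3
      rw [← Set.ncard_eq_toFinset_card Ω hfin]
      omega
    · intro ω hω ω' hω' heq
      by_contra hne
      refine hdiff ω (hfin.mem_toFinset.1 hω) ω' (hfin.mem_toFinset.1 hω') hne ?_
      exact Ideal.pow_le_self hN.ne' ((Ideal.Quotient.eq).1 heq)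

/-- A transversal for the residue map to `O ⧸ P ^ i` in a finite set. -/
theorem exists_transversal_factorPow {O : Type*} [CommRing O] {ϖ : O} {N i : ℕ} (hi : i ≤ N)
    (A : Set (O ⧸ Ideal.span {ϖ} ^ N)) :
    ∃ B ⊆ A, B.ncard = (Ideal.Quotient.factorPow (Ideal.span {ϖ}) hi '' A).ncard ∧
      ∀ b ∈ B, ∀ b' ∈ B,
        Ideal.Quotient.mk (Ideal.span {ϖ} ^ N) ϖ ^ i ∣ b - b' → b = b' := by
  obtain ⟨B, hBA, hB⟩ :=
    (Set.surjOn_image (Ideal.Quotient.factorPow (Ideal.span {ϖ}) hi) A).exists_bijOn_subset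
  refine ⟨B, hBA, ?_, fun b hb b' hb' hd => hB.injOn hb hb' ?_⟩
  · rw [← hB.image_eq, hB.injOn.ncard_image]
  · obtain ⟨w, hw⟩ := hd
    rw [← sub_eq_zero, ← map_sub, hw, map_mul, map_pow]
    have : Ideal.Quotient.factorPow (Ideal.span {ϖ}) hi (Ideal.Quotient.mk _ ϖ) ^ i = 0 := by
      change Ideal.Quotient.mk (Ideal.span {ϖ} ^ i) ϖ ^ i = 0
      rw [← map_pow, Ideal.Quotient.eq_zero_iff_mem]
      exact Ideal.pow_mem_pow (Ideal.mem_span_singleton_self ϖ) i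
    rw [this, zero_mul]

/-- The sum-product statement for a principal maximal ideal with finite residue field. -/
theorem exists_representative_card_le {O : Type*} [CommRing O] [IsDomain O] {ϖ : O} (hϖ : ϖ ≠ 0)
    [(Ideal.span {ϖ}).IsMaximal] [Finite (O ⧸ Ideal.span {ϖ})] {ε δ δ₀ : ℝ} (hε : 0 < ε)
    (hδ₀ : δ₀ = ε ^ 5 / 2000) (hδ' : δ ≤ δ₀) {q : ℕ} (hq : q = Nat.card (O ⧸ Ideal.span {ϖ}))
    (hq2 : 2 ≤ q) (hqδ : 3 ≤ δ₀ * Real.log q) {N : ℕ} {Ω : Set O}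
    {A : Set (O ⧸ Ideal.span {ϖ} ^ N)}
    (hΩ : Set.BijOn (Ideal.Quotient.mk (Ideal.span {ϖ})) Ω {x | IsUnit x})
    (hA : (A.ncard : ℝ) ≤ (q : ℝ) ^ ((N : ℝ) * (1 - ε)))
    (hproj : ∀ (i : ℕ) (hi : i ≤ N), (N : ℝ) * δ ≤ (i : ℝ) →
      (q : ℝ) ^ ((i : ℝ) * ε) ≤
        ((Ideal.Quotient.factorPow (Ideal.span {ϖ}) hi '' A).ncard : ℝ))
    (hval : ∀ i : ℕ, i ≤ 1 → ∃ a ∈ A, ∃ b ∈ A,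
      a - b ∈ Ideal.Quotient.mk (Ideal.span {ϖ} ^ N) ''
        ((↑(Ideal.span {ϖ} ^ i) : Set O) \ ↑(Ideal.span {ϖ} ^ (i + 1)))) :
    ∃ ω ∈ Ω, (A.ncard : ℝ) * (q : ℝ) ^ ((N : ℝ) * δ) ≤
      ((gen A 6 + Ideal.Quotient.mk (Ideal.span {ϖ} ^ N) ω • gen A 6).ncard : ℝ) := by
  have hq2R : (2 : ℝ) ≤ q := by exact_mod_cast hq2
  have hL : 0 < Real.log q := Real.log_pos (by linarith)
  have hfinN : Finite (O ⧸ Ideal.span {ϖ} ^ N) :=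
    Ideal.finite_quotient_pow ⟨{ϖ}, by simp⟩ N
  have hAne : A.Nonempty := by
    obtain ⟨a, ha, -⟩ := hval 0 (by norm_num)
    exact ⟨a, ha⟩
  have hApos : (0 : ℝ) < A.ncard := by exact_mod_cast (Set.ncard_pos).2 hAne
  have hgen : (gen A 6).Nonempty := by
    obtain ⟨a, ha⟩ := hAne
    exact ⟨_, pow_mul_sub_mem_gen ha ha ha⟩
  have hSne : ∀ ω : O,
      (0 : ℝ) < (gen A 6 + Ideal.Quotient.mk (Ideal.span {ϖ} ^ N) ω • gen A 6).ncard := fun ω =>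
    have hf : Set.Finite (gen A 6 + Ideal.Quotient.mk (Ideal.span {ϖ} ^ N) ω • gen A 6) :=
      Set.toFinite _
    have hn : Set.Nonempty (gen A 6 + Ideal.Quotient.mk (Ideal.span {ϖ} ^ N) ω • gen A 6) :=
      Set.Nonempty.add hgen (Set.Nonempty.smul_set hgen)
    Nat.cast_pos.2 ((Set.ncard_pos hf).2 hn)
  rcases Nat.eq_zero_or_pos N with rfl | hN
  · obtain ⟨ω, hω, -⟩ := hΩ.surjOn (show (1 : _ ⧸ _) ∈ {x | IsUnit x} from isUnit_one)
    refine ⟨ω, hω, ?_⟩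
    have hsub : Subsingleton (O ⧸ Ideal.span {ϖ} ^ 0) := by
      rw [pow_zero, Ideal.one_eq_top]
      infer_instance
    have h1 : (A.ncard : ℝ) ≤ 1 := by
      exact_mod_cast Set.ncard_le_one_of_subsingleton A
    have h2 := Nat.one_le_cast (α := ℝ).2 (Nat.cast_pos.1 (hSne ω))
    simpa using h1.trans h2
  have hNR : (0 : ℝ) < N := by exact_mod_cast hN
  have hA1 : (1 : ℝ) ≤ A.ncard := by exact_mod_cast (Set.ncard_pos).2 hAne
  -- For N > 0 and ε > 1 the upper bound on |A| would be below 1, yet A is nonempty.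
  have hε1 : ε ≤ 1 := by
    by_contra! hlt
    have := Real.rpow_lt_one_of_one_lt_of_neg (x := q) (z := N * (1 - ε)) (by linarith)
      (mul_neg_of_pos_of_neg hNR (by linarith))
    linarith
  have hR := isTruncatedDVR_quotient_pow hϖ N
  rw [← hq] at hR
  obtain ⟨Ω', hΩ'mem, hΩ'unit, hΩ'card⟩ := exists_finset_representatives hN hΩ
  rw [← hq] at hΩ'card
  set π := Ideal.Quotient.mk (Ideal.span {ϖ} ^ N) ϖ with hπ
  have hvaldvd : ∀ i : ℕ, i ≤ 1 → i + 1 ≤ N → ∃ a ∈ A, ∃ b ∈ A, π ^ i ∣ a - b ∧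
      ¬ π ^ (i + 1) ∣ a - b := by
    intro i hi hiN
    obtain ⟨a, ha, b, hb, z, ⟨hz1, hz2⟩, hz⟩ := hval i hi
    refine ⟨a, ha, b, hb, ?_, ?_⟩
    · rw [← hz, hπ, Ideal.Quotient.pow_mk_dvd_mk_iff (by omega)]
      exact hz1
    · rw [← hz, hπ, Ideal.Quotient.pow_mk_dvd_mk_iff hiN]
      exact hz2
  have hAfin := A.toFinite
  have hAcard : hAfin.toFinset.card = A.ncard := (Set.ncard_eq_toFinset_card A hAfin).symm
  -- The critical δ₀ suffices: the projection hypothesis for δ ≤ δ₀ covers all i ≥ Nδ₀, and growth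
  -- by q^(Nδ₀) implies growth by q^(Nδ).
  obtain ⟨w, hw, hlt⟩ := hR.exists_log_card_lt hN hq2 hε hε1 hδ₀ hqδ hΩ'unit hΩ'card
    (A := hAfin.toFinset)
    (S := fun w => (Set.toFinite (gen A 6 + w • gen A 6)).toFinset)
    (by
      rw [hAcard]
      have := Real.log_le_log hApos hA
      rwa [Real.log_rpow (by linarith)] at this)
    (by
      intro i hi hiN
      obtain ⟨B, hBA, hBcard, hB⟩ := exists_transversal_factorPow hiN A
      have h1 := hproj i hiN ((mul_le_mul_of_nonneg_left hδ' hNR.le).trans hi)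
      rw [← hBcard] at h1
      have h2 : (0 : ℝ) < q ^ ((i : ℝ) * ε) := Real.rpow_pos_of_pos (by linarith) _
      have h3 : 0 < B.ncard := by exact_mod_cast h2.trans_le h1
      refine ⟨B.toFinite.toFinset, by simpa using hBA, ?_, ?_, ?_⟩
      · simpa using (Set.ncard_pos).1 h3
      · simpa using hB
      · rw [← Set.ncard_eq_toFinset_card B, ← Real.log_rpow (by linarith)]
        exact Real.log_le_log h2 h1)
    (by
      obtain ⟨a, ha, b, hb, -, hab⟩ := hvaldvd 0 (by norm_num) hN
      exact ⟨a, by simpa using ha, b, by simpa using hb, by simpa using hab⟩)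
    (by
      intro hN1
      obtain ⟨a, ha, b, hb, hab, hab'⟩ := hvaldvd 1 le_rfl hN1
      exact ⟨a, by simpa using ha, b, by simpa using hb, by simpa using hab, hab'⟩)
    (by
      intro ω _ x hx y hy
      rw [hAfin.coe_toFinset] at hx hy
      rw [Set.Finite.mem_toFinset]
      exact Set.add_mem_add hx (Set.smul_mem_smul_set hy))
  obtain ⟨ω, hω, rfl⟩ := hΩ'mem w hw
  refine ⟨ω, hω, ?_⟩
  rw [hAcard, ← Set.ncard_eq_toFinset_card, ← Real.log_rpow (by linarith),
    ← Real.log_mul hApos.ne' (Real.rpow_pos_of_pos (by linarith) _).ne'] at hlt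
  have h1 := (Real.log_lt_log_iff
    (mul_pos hApos (Real.rpow_pos_of_pos (by linarith) _)) (hSne ω)).1 hlt
  refine le_trans (mul_le_mul_of_nonneg_left ?_ hApos.le) h1.le
  exact Real.rpow_le_rpow_of_exponent_le (by linarith)
    (mul_le_mul_of_nonneg_left hδ' hNR.le)

theorem theorem1p4 :
    ∃ c : ℝ, 0 < c ∧ ∀ ε : ℝ, 0 < ε → ∃ q₀ : ℕ, ∀ δ : ℝ, 0 < δ → δ ≤ c * ε ^ 5 →
      ∀ (p : ℕ) [Fact p.Prime] (K : Type u) [Field K] [Algebra ℚ_[p] K]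
        [FiniteDimensional ℚ_[p] K] [Algebra ℤ_[p] K] [IsScalarTower ℤ_[p] ℚ_[p] K]
        (ϖ : integralClosure ℤ_[p] K) (P : Ideal (integralClosure ℤ_[p] K)),
        Irreducible ϖ → P = Ideal.span {ϖ} →
        ∀ q : ℕ, q = Nat.card (integralClosure ℤ_[p] K ⧸ P) → q₀ ≤ q →
        ∀ (N : ℕ) (Ω : Set (integralClosure ℤ_[p] K))
          (A : Set (integralClosure ℤ_[p] K ⧸ P ^ N)),
          Set.BijOn (Ideal.Quotient.mk P) Ω {x | IsUnit x} →
          (A.ncard : ℝ) ≤ (q : ℝ) ^ ((N : ℝ) * (1 - ε)) →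
          (∀ (i : ℕ) (hi : i ≤ N), (N : ℝ) * δ ≤ (i : ℝ) →
            (q : ℝ) ^ ((i : ℝ) * ε) ≤ ((Ideal.Quotient.factorPow P hi '' A).ncard : ℝ)) →
          (∀ i : ℕ, i ≤ 1 → ∃ a ∈ A, ∃ b ∈ A,
            a - b ∈ Ideal.Quotient.mk (P ^ N) ''
              ((↑(P ^ i) : Set (integralClosure ℤ_[p] K)) \ ↑(P ^ (i + 1)))) →
          ∃ ω ∈ Ω, (A.ncard : ℝ) * (q : ℝ) ^ ((N : ℝ) * δ) ≤
            ((gen A 6 + Ideal.Quotient.mk (P ^ N) ω • gen A 6).ncard : ℝ) := by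
  refine ⟨1 / 2000, by norm_num, fun ε hε => ?_⟩
  have hδ₀pos : 0 < ε ^ 5 / 2000 := by positivity
  -- Chosen so that 3 ≤ δ₀ log q for δ₀ = ε^5/2000.
  refine ⟨max 2 ⌈Real.exp (3 / (ε ^ 5 / 2000))⌉₊, ?_⟩
  intro δ hδ hδle p _ K _ _ _ _ _ ϖ P hϖ hP q hq hq₀ N Ω A hΩ hA hproj hval
  subst hP
  have hq2 : 2 ≤ q := (le_max_left _ _).trans hq₀
  have hqpos : (0 : ℝ) < q := by exact_mod_cast (by omega : 0 < q)
  have := Padic.isMaximal_span_irreducible hϖ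
  -- `Nat.card` of an infinite type is 0, so q ≥ 2 already forces finiteness.
  have : Finite (integralClosure ℤ_[p] K ⧸ Ideal.span {ϖ}) :=
    Nat.finite_of_card_ne_zero (by omega)
  refine exists_representative_card_le hϖ.ne_zero hε rfl (by linarith) hq hq2 ?_ hΩ hA hproj hval
  have h1 : Real.exp (3 / (ε ^ 5 / 2000)) ≤ q :=
    (Nat.le_ceil _).trans (by exact_mod_cast (le_max_right _ _).trans hq₀)
  have h2 := (Real.le_log_iff_exp_le hqpos).2 h1
  rwa [div_le_iff₀' hδ₀pos] at h2
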